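/- **Setting.** Let $d\ge 1$ and $t=\lfloor (d-1)/2\rfloor$. The planar surface code of size $d$ has $d$ rows of $d-1$ sites. Its data qubits are the edges: the $d^2$ horizontal edges ($d$ in each row; the first comes from the left boundary and the last goes to the right boundary) and the $(d-1)^2$ vertical edges between vertically adjacent sites. The generators are, for each site, the product of $X$ over the incident edges and, for each plaquette, the product of $Z$ over the surrounding edges. Pauli operators are considered modulo phase; the weight of a Pauli operator is the number of qubits on which it is not the identity. **Bubble clustering (BC) decoder.** $Z$ errors are decoded on this lattice from the set of defects (the sites whose $X$ generator anticommutes with the error), and $X$ errors in the same way on the dual lattice, i.e. after reflection in the diagonal. On one lattice, with $n_{\mathrm d}$ defects: 1. *Radius.* $R=t+2-\lceil n_{\mathrm d}/2\rceil$. 2. *Clustering.* The first unassigned defect (from left to right and top to bottom) starts a new cluster. The defects of the cluster are processed in turn: every unassigned defect at Manhattan distance $\le R$ from the one being processed joins the cluster, as a neighbour of it in the cluster's tree. When all its defects are processed, the cluster is complete. This is repeated until every defect is assigned. 3. *First matching $\mathcal E^1$ of each cluster.* All defects of the cluster are switched on. If their number is odd, a ghost ancilla is attached to the defect closest to a (left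 or right) boundary (among several: to one whose nearest neighbour in the cluster is farthest away, then to the first from left to right and top to bottom): the straight horizontal path from it to its nearest boundary is added to the matching and the defect is switched off. Then the tree is peeled: in repeated sweeps through the cluster, each defect $u$ that has exactly one neighbour $v$ in the remaining tree loses the edge $uv$; if $u$ was on, then $u$ is switched off, $v$ is flipped, and the path that runs from $u$ vertically to the row of $v$ and then horizontally to $v$ is added (modulo 2) to the matching. The order within a sweep, and the boundary chosen when the selected defect is equidistant from both, are arbitrary. 4. *Second matching $\mathcal E^2$.* The same with other ghost ancillas, each flipping its defect: for an odd number of defects, one at the boundary opposite to the one used in step 3, attached to the defect nearest to that boundary; for an even number, one at each boundary, attached to the defect nearest to that boundary (same rule among several). 5. *Post-processing.* With $w^j=|\mathcal E^j|$ the number of qubits, choose $\mathcal E^1$ if $w^1\le t$; else $\mathcal E^2$ if $w^2\le t$; else $\mathcal E^1$ if $w^1=t+1$; else $\mathcal E^2$ if $w^2=t+1$; else the one that minimizes $f(\mathcal E^j)$, the number of columns $k\in\{1,\dots,d\}$ such that $\mathcal E^j$ contains an odd number of the $k$-th horizontal edges of the rows ($\mathcal E^1$ in case of equality). The correction is the sum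 modulo 2 of the chosen matchings of all clusters. **Theorem.** The planar surface code of size $d$ is a $[[d^2+(d-1)^2,1,d]]$ stabilizer code: the generators commute and are independent, and the least weight of a logical operator (one that commutes with the stabilizer and is not in it) is $d$. Every Pauli error $E$ of weight $w\le t$ is corrected by the BC decoder: if $C$ is the correction that it returns for the syndrome of $E$, then $CE$ belongs to the stabilizer up to phase. -/

import Mathlib

/-! # Stabilizer formalism (Pauli operators modulo phases) -/

/-- A Pauli pattern on the qubits `Q`, modulo global phase.  At each qubit the pair `(x, z)` stands
for `X ^ x * Z ^ z`, so `(0,0) = I`, `(1,0) = X`, `(0,1) = Z`, `(1,1) = Y`.  Multiplication of Pauli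
operators modulo phase is addition of patterns. -/
abbrev PauliPattern (Q : Type*) := Q → ZMod 2 × ZMod 2

/-- The weight: the number of qubits on which the pattern is not the identity. -/
def PauliPattern.weight {Q : Type*} [Fintype Q] (P : PauliPattern Q) : ℕ :=
  (Finset.univ.filter fun q => P q ≠ 0).card

/-- `0` if the two operators commute, `1` if they anticommute. -/
def PauliPattern.symp {Q : Type*} [Fintype Q] (P R : PauliPattern Q) : ZMod 2 :=
  ∑ q, ((P q).1 * (R q).2 + (P q).2 * (R q).1)

/-- The stabilizer (modulo phases): all products of generators. -/
def stabilizerOf {Q G : Type*} (gen : G → PauliPattern Q) :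
    Submodule (ZMod 2) (PauliPattern Q) :=
  Submodule.span (ZMod 2) (Set.range gen)

/-- The error syndrome: which generators anticommute with `E`. -/
def syndromeOf {Q G : Type*} [Fintype Q] (gen : G → PauliPattern Q) (E : PauliPattern Q) :
    G → ZMod 2 :=
  fun g => (gen g).symp E

/-- A logical operator commutes with the stabilizer but is not part of it. -/
def IsLogical {Q G : Type*} [Fintype Q] (gen : G → PauliPattern Q) (P : PauliPattern Q) : Prop :=
  (∀ S ∈ stabilizerOf gen, PauliPattern.symp S P = 0) ∧ P ∉ stabilizerOf gen

/-- `gen` defines an `[[n, k, d]]` stabilizer code: `n` qubits, `n - k` independent commuting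
generators, and `d` is the smallest weight of a logical operator. -/
structure IsStabilizerCode {Q G : Type*} [Fintype Q] [Fintype G] (gen : G → PauliPattern Q)
    (n k d : ℕ) : Prop where
  card_qubits : Fintype.card Q = n
  commute : ∀ g h, (gen g).symp (gen h) = 0
  independent : LinearIndependent (ZMod 2) gen
  card_generators : Fintype.card G + k = n
  distance : IsLeast {w | ∃ P : PauliPattern Q, IsLogical gen P ∧ P.weight = w} d

namespace SurfaceCode

/-! # The planar surface code

Sites are arranged in `d` rows and `d - 1` columns.  The data qubits are the edges:
* `Sum.inl (r, c)`: the horizontal edge number `c` of row `r`; it joins the sites `(r, c - 1)` and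
  `(r, c)`, the edge `c = 0` comes from the left boundary, `c = d - 1` goes to the right boundary;
* `Sum.inr (r, c)`: the vertical edge joining the sites `(r, c)` and `(r + 1, c)`. -/

abbrev Site (d : ℕ) := Fin d × Fin (d - 1)

/-- The plaquette `(r, c)` lies between the horizontal edges `(r, c)` and `(r + 1, c)`. -/
abbrev Plaquette (d : ℕ) := Fin (d - 1) × Fin d

abbrev Qubit (d : ℕ) := (Fin d × Fin d) ⊕ (Fin (d - 1) × Fin (d - 1))

/-- Labels of the generators: an `X` generator for each site, a `Z` generator for each plaquette. -/
abbrev GenLabel (d : ℕ) := Site d ⊕ Plaquette d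

/-- A set of edges, given by its indicator function; addition is symmetric difference (applying
the same operator twice to a qubit does nothing). -/
abbrev Chain (d : ℕ) := Qubit d → ZMod 2

/-- The edges incident to a site. -/
def star {d : ℕ} (v : Site d) : Chain d
  | Sum.inl (r, c) => if r = v.1 ∧ (c.val = v.2.val ∨ c.val = v.2.val + 1) then 1 else 0
  | Sum.inr (r, c) => if c = v.2 ∧ (r.val = v.1.val ∨ r.val + 1 = v.1.val) then 1 else 0

/-- The edges surrounding a plaquette. -/
def border {d : ℕ} (p : Plaquette d) : Chain d
  | Sum.inl (r, c) => if c = p.2 ∧ (r.val = p.1.val ∨ r.val = p.1.val + 1) then 1 else 0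
  | Sum.inr (r, c) => if r = p.1 ∧ (c.val = p.2.val ∨ c.val + 1 = p.2.val) then 1 else 0

/-- The generators of the surface code: `X` on the edges incident to a site, `Z` on the edges
surrounding a plaquette. -/
def generator (d : ℕ) : GenLabel d → PauliPattern (Qubit d)
  | Sum.inl v => fun q => (star v q, 0)
  | Sum.inr p => fun q => (0, border p q)

/-! # The bubble clustering decoder on the primal lattice (correction of `Z` errors) -/

/-- The number of qubits in a matching. -/
def Chain.weight {d : ℕ} (e : Chain d) : ℕ := (Finset.univ.filter fun q => e q ≠ 0).card

inductive Side where
  | left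
  | right

def Side.opposite : Side → Side
  | .left => .right
  | .right => .left

/-- All sites, from left to right and from top to bottom. -/
def allSites (d : ℕ) : List (Site d) := (List.finRange d).product (List.finRange (d - 1))

/-- The defects, from left to right and from top to bottom. -/
def defects {d : ℕ} (s : Site d → ZMod 2) : List (Site d) := (allSites d).filter fun v => s v = 1

/-- The Manhattan distance. -/
def manhattan {d : ℕ} (u v : Site d) : ℕ :=
  ((u.1.val : ℤ) - v.1.val).natAbs + ((u.2.val : ℤ) - v.2.val).natAbs

/-- The bubble radius for a number `nd` of defects. -/
def bubbleRadius (t nd : ℕ) : ℤ := (t : ℤ) + 2 - ⌈(nd : ℚ) / 2⌉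

/-! ## Bubble clustering -/

/-- A cluster: the list of its defects, and the edges of the tree that joins them. -/
structure Cluster (d : ℕ) where
  members : List (Site d)
  tree : List (Site d × Site d)

/-- The defects of the list in the bubble of radius `R` around `u`. -/
def inBubble {d : ℕ} (R : ℤ) (u : Site d) (l : List (Site d)) : List (Site d) :=
  l.filter fun v => decide ((manhattan u v : ℤ) ≤ R)

/-- The defects of the list outside the bubble of radius `R` around `u`. -/
def outBubble {d : ℕ} (R : ℤ) (u : Site d) (l : List (Site d)) : List (Site d) :=
  l.filter fun v => ! decide ((manhattan u v : ℤ) ≤ R)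

theorem length_bubble {d : ℕ} (R : ℤ) (u : Site d) (l : List (Site d)) :
    l.length = (inBubble R u l).length + (outBubble R u l).length :=
  List.length_eq_length_filter_add _

/-- The completion of one cluster.  The first argument lists the defects of the cluster that still
have to be processed, the second one the defects that belong to no cluster so far.  Each defect in
turn is processed: all unassigned defects in its bubble are appended to the cluster, as
neighbours of the defect being processed.  Returned are the defects and the tree edges of the
cluster, and the defects that remain unassigned. -/
def growCluster {d : ℕ} (R : ℤ) :
    List (Site d) → List (Site d) → List (Site d) × List (Site d × Site d) × List (Site d)
  | [], rest => ([], [], rest)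
  | cur :: queue, rest =>
    let out := growCluster R (queue ++ inBubble R cur rest) (outBubble R cur rest)
    (cur :: out.1, (inBubble R cur rest).map (Prod.mk cur) ++ out.2.1, out.2.2)
termination_by queue rest => queue.length + rest.length
decreasing_by
  have h := length_bubble R cur rest
  simp only [List.length_append, List.length_cons]
  omega

theorem length_growCluster_le {d : ℕ} (R : ℤ) (queue rest : List (Site d)) :
    (growCluster R queue rest).2.2.length ≤ rest.length := by
  fun_induction growCluster R queue rest with
  | case1 rest => exact le_rfl
  | case2 rest cur queue out ih => exact ih.trans (List.length_filter_le _ _)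

/-- As long as there are unassigned defects, the first of them starts a new cluster. -/
def clusters {d : ℕ} (R : ℤ) : List (Site d) → List (Cluster d)
  | [] => []
  | v :: rest =>
    ⟨(growCluster R [v] rest).1, (growCluster R [v] rest).2.1⟩ ::
      clusters R (growCluster R [v] rest).2.2
termination_by l => l.length
decreasing_by
  exact Nat.lt_succ_of_le (length_growCluster_le R [v] rest)

/-! ## Ghost ancillas -/

/-- The number of edges from a site, along its row, to a boundary. -/
def boundaryDist {d : ℕ} (v : Site d) : Side → ℕ
  | .left => v.2.val + 1
  | .right => d - 1 - v.2.val

/-- The distance from `v` to its nearest neighbour in the list. -/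
def neighbourDist {d : ℕ} (l : List (Site d)) (v : Site d) : ℕ :=
  (((l.filter fun u => u ≠ v).map (manhattan v)).min?).getD 0

/-- The defect of the list for which `dist` is smallest; among these one whose nearest neighbour is
farthest away; among these the first one from left to right and from top to bottom. -/
def nearestDefect {d : ℕ} (l : List (Site d)) (dist : Site d → ℕ) : Option (Site d) :=
  ((allSites d).filter fun v => v ∈ l).argmin fun v =>
    toLex (dist v, OrderDual.toDual (neighbourDist l v))

/-- The boundary nearest to `v`; `tie` is consulted if they are equidistant. -/
def nearestSide {d : ℕ} (tie : Site d → Side) (v : Site d) : Side :=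
  if boundaryDist v .left < boundaryDist v .right then .left
  else if boundaryDist v .right < boundaryDist v .left then .right
  else tie v

/-- The ghost ancillas in the first peeling phase: for an odd number of defects, one at the
boundary nearest to a defect. -/
def firstGhosts {d : ℕ} (tie : Site d → Side) (l : List (Site d)) : List (Site d × Side) :=
  if Odd l.length then
    (nearestDefect l fun v => min (boundaryDist v .left) (boundaryDist v .right)).toList.map
      fun v => (v, nearestSide tie v)
  else []

/-- The ghost ancilla attached to the defect nearest to a given boundary. -/
def ghostAt {d : ℕ} (l : List (Site d)) (b : Side) : List (Site d × Side) :=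
  (nearestDefect l fun v => boundaryDist v b).toList.map fun v => (v, b)

/-- The ghost ancillas in the second peeling phase: for an odd number of defects, one at the
boundary opposite to the one of the first phase; for an even number, one at each boundary. -/
def secondGhosts {d : ℕ} (tie : Site d → Side) (l : List (Site d)) : List (Site d × Side) :=
  if Odd l.length then
    (firstGhosts tie l).flatMap fun g => ghostAt l g.2.opposite
  else ghostAt l .left ++ ghostAt l .right

/-! ## Peeling -/

/-- The path from `u` to `v`: first vertically in the column of `u`, then horizontally in the row
of `v`. -/
def buildMatch {d : ℕ} (u v : Site d) : Chain d
  | Sum.inl (r, c) =>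
    if r = v.1 ∧ min u.2.val v.2.val < c.val ∧ c.val ≤ max u.2.val v.2.val then 1 else 0
  | Sum.inr (r, c) =>
    if c = u.2 ∧ min u.1.val v.1.val ≤ r.val ∧ r.val < max u.1.val v.1.val then 1 else 0

/-- The straight horizontal path from a site to a boundary. -/
def buildGhostMatch {d : ℕ} (g : Site d × Side) : Chain d
  | Sum.inl (r, c) =>
    match g.2 with
    | .left => if r = g.1.1 ∧ c.val ≤ g.1.2.val then 1 else 0
    | .right => if r = g.1.1 ∧ g.1.2.val < c.val then 1 else 0
  | Sum.inr _ => 0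

/-- The state of the peeling: which defects are switched on, the edges that are left of the tree,
and the matching built so far. -/
structure PeelState (d : ℕ) where
  on : Site d → ZMod 2
  tree : List (Site d × Site d)
  chain : Chain d

/-- All defects of the cluster are switched on; then the ghost ancillas are peeled. -/
def initPeel {d : ℕ} (C : Cluster d) (ghosts : List (Site d × Side)) : PeelState d where
  on := fun v => (if v ∈ C.members then 1 else 0) + ((ghosts.filter fun g => g.1 = v).length : ZMod 2)
  tree := C.tree
  chain := (ghosts.map buildGhostMatch).sum

/-- If `u` has order one in the remaining tree, it is peeled. -/
def peelVertex {d : ℕ} (st : PeelState d) (u : Site d) : PeelState d :=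
  match st.tree.filter fun e => e.1 = u ∨ e.2 = u with
  | [e] =>
    let adj := if e.1 = u then e.2 else e.1
    if st.on u = 1 then
      { on := fun x => if x = u then 0 else if x = adj then 1 - st.on adj else st.on x
        tree := st.tree.erase e
        chain := st.chain + buildMatch u adj }
    else { st with tree := st.tree.erase e }
  | _ => st

/-- The matching obtained by peeling.  The defects of the cluster are swept through in the order
given by `order` until the tree is empty: each sweep through a nonempty tree removes at least one
edge, and sweeps through an empty tree do nothing. -/
def peel {d : ℕ} (order : List (Site d) → List (Site d)) (C : Cluster d)
    (ghosts : List (Site d × Side)) : Chain d :=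
  ((fun st => (order C.members).foldl peelVertex st)^[C.tree.length] (initPeel C ghosts)).chain

/-! ## Post-processing -/

/-- The number of columns that a matching crosses an odd number of times; the `k`-th column
consists of the `k`-th horizontal edges of all rows. -/
def columnMetric {d : ℕ} (e : Chain d) : ℕ :=
  ∑ k : Fin d, (Finset.univ.filter fun r : Fin d => e (Sum.inl (r, k)) ≠ 0).card % 2

/-- The choice between the two matchings of a cluster. -/
def selectMatching {d : ℕ} (t : ℕ) (e₁ e₂ : Chain d) : Chain d :=
  if e₁.weight ≤ t then e₁
  else if e₂.weight ≤ t then e₂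
  else if e₁.weight = t + 1 then e₁
  else if e₂.weight = t + 1 then e₂
  else if columnMetric e₁ ≤ columnMetric e₂ then e₁
  else e₂

/-- The correction on one cluster. -/
def decodeCluster {d : ℕ} (t : ℕ) (tie : Site d → Side) (order : List (Site d) → List (Site d))
    (C : Cluster d) : Chain d :=
  selectMatching t (peel order C (firstGhosts tie C.members))
    (peel order C (secondGhosts tie C.members))

/-- The bubble clustering decoder on one lattice. -/
def decodeLattice {d : ℕ} (t : ℕ) (tie : Site d → Side) (order : List (Site d) → List (Site d))
    (s : Site d → ZMod 2) : Chain d :=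
  ((clusters (bubbleRadius t (defects s).length) (defects s)).map (decodeCluster t tie order)).sum

/-! # The full decoder -/

/-- The reflection of the lattice in its diagonal.  It exchanges the primal and the dual lattice:
it maps the borders of the plaquettes to the stars of the sites. -/
def transpose {d : ℕ} : Qubit d → Qubit d
  | Sum.inl (r, c) => Sum.inl (c, r)
  | Sum.inr (r, c) => Sum.inr (c, r)

/-- The bubble clustering decoder: from the syndrome, the `Z` errors are estimated on the primal
lattice and the `X` errors on the dual lattice. -/
def bcDecoder {d : ℕ} (t : ℕ) (tie : Site d → Side) (order : List (Site d) → List (Site d))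
    (s : GenLabel d → ZMod 2) : PauliPattern (Qubit d) :=
  let zPart := decodeLattice t tie order fun v => s (Sum.inl v)
  let xPart := decodeLattice t tie order fun v => s (Sum.inr (v.2, v.1))
  fun q => (xPart (transpose q), zPart q)

end SurfaceCode

/-! A Pauli operator modulo phase splits into a `Z` part and an `X` part. Reflected in the diagonal,
the `X` part lives on the same lattice as the `Z` part, so everything reduces to chains modulo 2 on
one lattice, neither part being heavier than the operator.

The homology is detected by column parities. For a chain without syndrome the parity of crossings is
the same in all `d` columns (`columnParity_eq`), and the chain is a sum of plaquette borders exactly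
when this parity is even (`mem_bordersSpan`, `columnParity_of_mem_bordersSpan`). An odd cycle
therefore meets every column and has at least `d` edges (`le_weight`); a straight row attains this,
which gives the distance.

For decoding, take an error of weight at most `t`. A path inside the error between two defects uses
edges that are no longer available to produce the remaining defects; this count keeps the path
within the bubble radius (`manhattan_le_bubbleRadius`). Hence clusters never cut a component of the
error, and each cluster is the syndrome of a piece `f` of the error (`exists_cluster_error`).

Peeling a cluster gives matchings `a` and `b` with the syndrome of `f`. Their ghost paths make `a +
b` an odd cycle, so exactly one of `f + a`, `f + b` is trivial. The post-processing finds it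
(`selectMatching_correct`). A matching of weight at most `t` is right, since `2 * t < d`. One of
weight `t + 1` could fail only if it and `f` filled a row; then the other matching would be `f`
itself and would have been chosen before. Otherwise the column metrics of `a` and `b` add up to `d`,
while that of the right matching is at most `t`. Summing over the clusters corrects the error up to
a short, hence trivial, cycle (`decodeLattice_correct`). -/

namespace SurfaceCode

variable {d : ℕ}

/-! ### The boundary operator and the column parities in coordinates -/

/-- The syndrome of a chain. -/
def boundary : Chain d →ₗ[ZMod 2] (Site d → ZMod 2) :=
  Matrix.mulVecLin (Matrix.of fun v q => star v q)

/-- The parity of the crossings of the column `k`. -/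
def columnParity (k : Fin d) : Chain d →ₗ[ZMod 2] ZMod 2 :=
  ∑ r : Fin d, LinearMap.proj (Sum.inl (r, k))

theorem columnParity_apply (k : Fin d) (e : Chain d) :
    columnParity k e = ∑ r : Fin d, e (Sum.inl (r, k)) := by
  simp [columnParity]

theorem boundary_apply (e : Chain d) (v : Site d) : boundary e v = ∑ q, star v q * e q := rfl

theorem zmod_two_ne_zero {a : ZMod 2} : a ≠ 0 ↔ a = 1 := by
  revert a; decide

theorem zmod_two_add_eq_zero {a b : ZMod 2} : a + b = 0 ↔ a = b := by
  revert a b; decide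

theorem add_self_zmod_two {ι : Type*} (f : ι → ZMod 2) : f + f = 0 :=
  funext fun _ => CharTwo.add_self_eq_zero _

/-- The value of a chain on the horizontal edge `c` of the row `r`, zero outside the lattice. -/
def horiz (e : Chain d) (r c : ℕ) : ZMod 2 :=
  if h : r < d ∧ c < d then e (Sum.inl (⟨r, h.1⟩, ⟨c, h.2⟩)) else 0

/-- The value of a chain on the vertical edge below the site `(r, c)`, zero outside the lattice. -/
def vert (e : Chain d) (r c : ℕ) : ZMod 2 :=
  if h : r < d - 1 ∧ c < d - 1 then e (Sum.inr (⟨r, h.1⟩, ⟨c, h.2⟩)) else 0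

theorem horiz_val (e : Chain d) (r c : Fin d) : horiz e r c = e (Sum.inl (r, c)) := by
  simp [horiz]

theorem vert_val (e : Chain d) (r c : Fin (d - 1)) : vert e r c = e (Sum.inr (r, c)) := by
  simp [vert]

theorem star_eq_single (v : Site d) :
    star v = Pi.single (Sum.inl (v.1, ⟨v.2, by omega⟩)) 1
      + Pi.single (Sum.inl (v.1, ⟨v.2 + 1, by omega⟩)) 1
      + (if h : v.1.val < d - 1 then Pi.single (Sum.inr (⟨v.1, h⟩, v.2)) 1 else 0)
      + (if h : 0 < v.1.val then Pi.single (Sum.inr (⟨v.1 - 1, by omega⟩, v.2)) 1 else 0) := by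
  obtain ⟨⟨a, ha⟩, ⟨b, hb⟩⟩ := v
  funext q
  rcases q with ⟨⟨r, hr⟩, ⟨c, hc⟩⟩ | ⟨⟨r, hr⟩, ⟨c, hc⟩⟩
  · have h1 : (if h : a < d - 1 then Pi.single (Sum.inr (⟨a, h⟩, ⟨b, hb⟩)) 1 else 0 : Chain d)
        (Sum.inl (⟨r, hr⟩, ⟨c, hc⟩)) = 0 := by split_ifs <;> simp
    have h2 : (if h : 0 < a then Pi.single (Sum.inr (⟨a - 1, by omega⟩, ⟨b, hb⟩)) 1 else 0 : Chain d)
        (Sum.inl (⟨r, hr⟩, ⟨c, hc⟩)) = 0 := by split_ifs <;> simp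
    simp only [Pi.add_apply, h1, h2, star, Pi.single_apply, Sum.inl.injEq, Prod.mk.injEq,
      Fin.mk.injEq, add_zero]
    split_ifs <;> first | omega | rfl
  · have h1 : (if h : a < d - 1 then Pi.single (Sum.inr (⟨a, h⟩, ⟨b, hb⟩)) 1 else 0 : Chain d)
        (Sum.inr (⟨r, hr⟩, ⟨c, hc⟩)) = if r = a ∧ c = b then 1 else 0 := by
      split_ifs with h h' h' <;> simp [Pi.single_apply] <;> omega
    have h2 : (if h : 0 < a then Pi.single (Sum.inr (⟨a - 1, by omega⟩, ⟨b, hb⟩)) 1 else 0 : Chain d)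
        (Sum.inr (⟨r, hr⟩, ⟨c, hc⟩)) = if r + 1 = a ∧ c = b then 1 else 0 := by
      split_ifs with h h' h' <;> simp [Pi.single_apply] <;> omega
    simp only [Pi.add_apply, h1, h2, star, Pi.single_apply, reduceCtorEq, if_false, Fin.mk.injEq,
      zero_add]
    split_ifs <;> first | omega | rfl

/-- Only the edge above needs a case distinction: in the top row the truncated subtraction would
count the edge below a second time, whereas below the bottom row `vert` already vanishes. -/
theorem boundary_eq (e : Chain d) (v : Site d) :
    boundary e v = horiz e v.1 v.2 + horiz e v.1 (v.2 + 1) + vert e v.1 v.2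
      + if 0 < v.1.val then vert e (v.1 - 1) v.2 else 0 := by
  have h : boundary e v = star v ⬝ᵥ e := rfl
  have hv := v.2.isLt
  rw [h, star_eq_single, add_dotProduct, add_dotProduct, add_dotProduct, single_dotProduct,
    single_dotProduct]
  congr 1
  · congr 1
    · rw [horiz, horiz, dif_pos (by omega), dif_pos (by omega)]
      simp
    · rw [vert]
      split_ifs with h1 h2 h2
      · simp
      · omega
      · omega
      · simp
  · split_ifs with h1
    · rw [vert, dif_pos (by omega)]
      simp
    · simp

theorem star_transpose (v : Site d) (q : Qubit d) :
    star v (transpose q) = border (v.2, v.1) q := by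
  rcases q with ⟨r, c⟩ | ⟨r, c⟩ <;> rfl

theorem transpose_transpose (q : Qubit d) : transpose (transpose q) = q := by
  rcases q with ⟨r, c⟩ | ⟨r, c⟩ <;> rfl

/-! ### The homology of the lattice -/

theorem sum_horiz (e : Chain d) (k : Fin d) :
    columnParity k e = ∑ r ∈ Finset.range d, horiz e r k := by
  rw [columnParity_apply, Finset.sum_range]
  simp [horiz]

/-- Summing the syndrome over the upper part of a column of sites. -/
theorem sum_range_horiz (z : Chain d) (hz : boundary z = 0) (c : ℕ) (hc : c < d - 1) (n : ℕ)
    (hn : n < d) :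
    ∑ r ∈ Finset.range (n + 1), (horiz z r c + horiz z r (c + 1)) = vert z n c := by
  have key : ∀ r, r < d → horiz z r c + horiz z r (c + 1) + vert z r c
      + (if 0 < r then vert z (r - 1) c else 0) = 0 := fun r hr => by
    have := boundary_eq z (⟨r, hr⟩, ⟨c, hc⟩)
    rw [hz] at this
    exact this.symm
  induction n with
  | zero =>
    have := key 0 hn
    simp only [zero_add, Finset.range_one, Finset.sum_singleton, lt_irrefl, if_false, add_zero]
      at this ⊢
    exact zmod_two_add_eq_zero.1 this
  | succ n ih =>
    rw [Finset.sum_range_succ, ih (by omega)]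
    have := key (n + 1) hn
    simp only [Nat.succ_pos, if_true, Nat.add_sub_cancel] at this
    rw [← zmod_two_add_eq_zero, ← this]
    ring

/-- When the syndrome is summed over a whole column of sites, each vertical edge is counted twice,
and only the two adjacent columns of horizontal edges remain. -/
theorem columnParity_succ (z : Chain d) (hz : boundary z = 0) (c : ℕ) (hc : c + 1 < d) :
    columnParity ⟨c + 1, hc⟩ z = columnParity ⟨c, by omega⟩ z := by
  have h := sum_range_horiz z hz c (by omega) (d - 1) (by omega)
  rw [Nat.sub_add_cancel (by omega), Finset.sum_add_distrib, vert, dif_neg (by omega)] at h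
  rw [sum_horiz, sum_horiz]
  exact (zmod_two_add_eq_zero.1 h).symm

theorem columnParity_eq (z : Chain d) (hz : boundary z = 0) (k l : Fin d) :
    columnParity k z = columnParity l z := by
  have key : ∀ c (hc : c < d), columnParity ⟨c, hc⟩ z = columnParity ⟨0, by omega⟩ z := by
    intro c
    induction c with
    | zero => exact fun _ => rfl
    | succ c ih => exact fun hc => (columnParity_succ z hz c hc).trans (ih _)
  exact (key k k.2).trans (key l l.2).symm

theorem horiz_border (p : Plaquette d) (r c : ℕ) :
    horiz (border p) r c = if c = p.2.val ∧ (r = p.1.val ∨ r = p.1.val + 1) then 1 else 0 := by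
  obtain ⟨⟨a, ha⟩, ⟨b, hb⟩⟩ := p
  simp only [horiz, border, Fin.mk.injEq]
  split_ifs <;> first | omega | rfl

theorem vert_border (p : Plaquette d) (r c : ℕ) (hc : c < d - 1) :
    vert (border p) r c = if r = p.1.val ∧ (c = p.2.val ∨ c + 1 = p.2.val) then 1 else 0 := by
  obtain ⟨⟨a, ha⟩, ⟨b, hb⟩⟩ := p
  simp only [vert, border, Fin.mk.injEq]
  split_ifs <;> first | omega | rfl

/-- A site meets the border of a plaquette in no edge or in two edges. -/
theorem boundary_border (p : Plaquette d) : boundary (border p) = 0 := by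
  funext v
  obtain ⟨⟨a, ha⟩, ⟨b, hb⟩⟩ := p
  obtain ⟨⟨i, hi⟩, ⟨j, hj⟩⟩ := v
  rw [boundary_eq, horiz_border, horiz_border, vert_border _ _ _ hj, vert_border _ _ _ hj]
  simp only [Pi.zero_apply]
  have h2 : (if 0 < i then if i - 1 = a ∧ (j = b ∨ j + 1 = b) then 1 else 0 else 0 : ZMod 2)
      = if i = a + 1 ∧ (j = b ∨ j + 1 = b) then 1 else 0 := by
    split_ifs <;> first | omega | rfl
  rw [h2]
  by_cases h1 : i = a <;> by_cases h2 : i = a + 1 <;> by_cases h3 : j = b <;>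
    by_cases h4 : j + 1 = b <;> simp [h1, h2, h3, h4] <;> first | omega | decide

theorem columnParity_border (p : Plaquette d) (k : Fin d) : columnParity k (border p) = 0 := by
  rw [columnParity_apply]
  obtain ⟨⟨a, ha⟩, b⟩ := p
  have h : ∀ r : Fin d, border (⟨a, ha⟩, b) (Sum.inl (r, k))
      = (if r = ⟨a, by omega⟩ then (if k = b then 1 else 0) else 0)
        + (if r = ⟨a + 1, by omega⟩ then (if k = b then 1 else 0) else 0) := by
    intro r
    simp only [border, Fin.ext_iff]
    split_ifs <;> first | omega | rfl
  rw [Finset.sum_congr rfl fun r _ => h r, Finset.sum_add_distrib]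
  simp [CharTwo.add_self_eq_zero]

/-- The span of the borders of the plaquettes. -/
def bordersSpan (d : ℕ) : Submodule (ZMod 2) (Chain d) := Submodule.span (ZMod 2) (Set.range border)

theorem sum_border_inl (a : Plaquette d → ZMod 2) (r c : Fin d) :
    (∑ p, a p • border p) (Sum.inl (r, c))
      = (if h : r.val < d - 1 then a (⟨r, h⟩, c) else 0)
        + (if h : 0 < r.val then a (⟨r - 1, by omega⟩, c) else 0) := by
  have h : ∀ p : Plaquette d, (a p • border p) (Sum.inl (r, c))
      = (if h : r.val < d - 1 then (if p = (⟨r, h⟩, c) then a p else 0) else 0)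
        + (if h : 0 < r.val then (if p = (⟨r - 1, by omega⟩, c) then a p else 0) else 0) := by
    rintro ⟨⟨i, hi⟩, j⟩
    simp only [border, Pi.smul_apply, smul_eq_mul, Prod.mk.injEq, Fin.ext_iff]
    split_ifs <;> first | omega | simp
  rw [Finset.sum_apply, Finset.sum_congr rfl fun p _ => h p, Finset.sum_add_distrib]
  congr 1 <;> split_ifs <;> simp

theorem sum_border_inr (a : Plaquette d → ZMod 2) (r c : Fin (d - 1)) :
    (∑ p, a p • border p) (Sum.inr (r, c)) = a (r, ⟨c, by omega⟩) + a (r, ⟨c + 1, by omega⟩) := by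
  have h : ∀ p : Plaquette d, (a p • border p) (Sum.inr (r, c))
      = (if p = (r, ⟨c, by omega⟩) then a p else 0)
        + (if p = (r, ⟨c + 1, by omega⟩) then a p else 0) := by
    rintro ⟨i, ⟨j, hj⟩⟩
    simp only [border, Pi.smul_apply, smul_eq_mul, Prod.mk.injEq, Fin.ext_iff]
    split_ifs <;> first | omega | simp
  rw [Finset.sum_apply, Finset.sum_congr rfl fun p _ => h p, Finset.sum_add_distrib]
  simp

/-- A horizontal edge of the top row borders a single plaquette, so the coefficients of the first
row of plaquettes vanish; each further row of edges then kills the next row of plaquettes. -/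
theorem linearIndependent_border : LinearIndependent (ZMod 2) (border : Plaquette d → Chain d) := by
  rw [Fintype.linearIndependent_iff]
  intro a ha
  have key : ∀ n (hn : n < d - 1) (c : Fin d), a (⟨n, hn⟩, c) = 0 := by
    intro n
    induction n with
    | zero =>
      intro hn c
      have := sum_border_inl a ⟨0, by omega⟩ c
      rw [ha] at this
      simpa [hn] using this.symm
    | succ n ih =>
      intro hn c
      have := sum_border_inl a ⟨n + 1, by omega⟩ c
      rw [ha] at this
      simpa [hn, ih (by omega)] using this.symm
  exact fun p => key p.1 p.1.2 p.2

/-- Together with `columnParity_of_mem_bordersSpan` this computes the homology: the column parity is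
the only obstruction for a cycle to be a sum of borders. -/
theorem mem_bordersSpan (z : Chain d) (hz : boundary z = 0) (hc : ∀ k, columnParity k z = 0) :
    z ∈ bordersSpan d := by
  -- The coefficient of a plaquette is the parity of the edges of `z` above it in its column.
  -- Differences of vertically adjacent coefficients recover the horizontal edges, those of
  -- horizontally adjacent ones the vertical edges.
  have hz' : z = ∑ p : Plaquette d,
      (∑ r ∈ Finset.range (p.1.val + 1), horiz z r p.2) • border p := by
    funext q
    rcases q with ⟨⟨r, hr⟩, c⟩ | ⟨r, c⟩
    · rw [sum_border_inl, ← horiz_val z]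
      have h2 : (if h : 0 < r then ∑ i ∈ Finset.range (r - 1 + 1), horiz z i c else 0)
          = ∑ i ∈ Finset.range r, horiz z i c := by
        split_ifs with h
        · rw [Nat.sub_add_cancel h]
        · simp [show r = 0 by omega]
      simp only [h2]
      split_ifs with h1
      · rw [Finset.sum_range_succ, add_right_comm, CharTwo.add_self_eq_zero, zero_add]
      -- An edge of the bottom row has no plaquette below it; here the evenness of the column is
      -- what closes the gap.
      · have := hc c
        rw [sum_horiz, show Finset.range d = Finset.range (r + 1) by congr 1; omega, Finset.sum_range_succ] at this
        rw [zero_add]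
        exact (zmod_two_add_eq_zero.1 this).symm
    · rw [sum_border_inr, ← vert_val z, ← sum_range_horiz z hz c c.2 r (by omega),
        Finset.sum_add_distrib]
  rw [hz']
  exact Submodule.sum_mem _ fun p _ =>
    Submodule.smul_mem _ _ (Submodule.subset_span ⟨p, rfl⟩)

theorem columnParity_of_mem_bordersSpan {z : Chain d} (hz : z ∈ bordersSpan d) (k : Fin d) :
    columnParity k z = 0 := by
  have : bordersSpan d ≤ LinearMap.ker (columnParity k) := by
    rw [bordersSpan, Submodule.span_le]
    rintro _ ⟨p, rfl⟩
    exact columnParity_border p k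
  exact this hz

/-! ### Weights of cycles -/

theorem Chain.weight_add_le (e f : Chain d) : (e + f).weight ≤ e.weight + f.weight := by
  refine le_trans (Finset.card_le_card ?_) (Finset.card_union_le _ _)
  intro q
  simp only [Finset.mem_filter, Finset.mem_univ, true_and, Finset.mem_union, Pi.add_apply]
  contrapose!
  rintro ⟨h1, h2⟩
  rw [h1, h2, add_zero]

theorem Chain.weight_mono {e f : Chain d} (h : ∀ q, e q ≠ 0 → f q ≠ 0) : e.weight ≤ f.weight :=
  Finset.card_le_card (Finset.monotone_filter_right _ fun q _ => h q)

/-- The number of columns that a chain crosses an odd number of times is at most its weight. -/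
theorem card_columnParity_le (z : Chain d) :
    (Finset.univ.filter fun k => columnParity k z ≠ 0).card ≤ z.weight := by
  have : ∀ k, columnParity k z ≠ 0 → ∃ r, z (Sum.inl (r, k)) ≠ 0 := by
    intro k hk
    rw [columnParity_apply] at hk
    obtain ⟨r, -, hr⟩ := Finset.exists_ne_zero_of_sum_ne_zero hk
    exact ⟨r, hr⟩
  choose! r hr using this
  refine Finset.card_le_card_of_injOn (fun k => Sum.inl (r k, k)) ?_ ?_
  · intro k hk
    simp only [Finset.coe_filter, Finset.mem_univ, true_and, Set.mem_ofPred_eq] at hk ⊢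
    exact hr k hk
  · intro k _ l _ h
    simp only [Sum.inl.injEq, Prod.mk.injEq] at h
    exact h.2

/-- A cycle that crosses a column an odd number of times has at least `d` edges. -/
theorem le_weight (z : Chain d) (hz : boundary z = 0) (k : Fin d) (hk : columnParity k z ≠ 0) :
    d ≤ z.weight := by
  refine le_trans ?_ (card_columnParity_le z)
  rw [Finset.filter_true_of_mem fun l _ => by rwa [columnParity_eq z hz l k], Finset.card_univ,
    Fintype.card_fin]

theorem mem_bordersSpan_of_weight_lt (z : Chain d) (hz : boundary z = 0) (h : z.weight < d) :
    z ∈ bordersSpan d :=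
  mem_bordersSpan z hz fun k => by
    by_contra hk
    exact absurd (le_weight z hz k hk) (by omega)

/-- A logical operator of the smallest weight occupies a row. -/
theorem exists_row (z : Chain d) (hz : boundary z = 0) (k : Fin d) (hk : columnParity k z ≠ 0)
    (h : z.weight ≤ d) :
    ∃ r : Fin d, ∀ q, z q ≠ 0 → ∃ c, q = Sum.inl (r, c) := by
  have hcol : ∀ l, columnParity l z ≠ 0 := fun l => by rwa [columnParity_eq z hz l k]
  have : ∀ l, ∃ r, z (Sum.inl (r, l)) ≠ 0 := by
    intro l
    have hl := hcol l
    rw [columnParity_apply] at hl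
    obtain ⟨r, -, hr⟩ := Finset.exists_ne_zero_of_sum_ne_zero hl
    exact ⟨r, hr⟩
  choose r hr using this
  -- One edge from each of the `d` columns already exhausts the weight, so there are no others.
  have himg : Finset.univ.image (fun l : Fin d => (Sum.inl (r l, l) : Qubit d))
      = Finset.univ.filter fun q => z q ≠ 0 := by
    refine Finset.eq_of_subset_of_card_le ?_ ?_
    · intro q hq
      obtain ⟨l, -, rfl⟩ := Finset.mem_image.1 hq
      simpa using hr l
    · rw [Finset.card_image_of_injective _ (fun a b hab => by simpa using (Prod.ext_iff.1 (Sum.inl.inj hab)).2)]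
      rw [Finset.card_univ, Fintype.card_fin]
      exact h
  have hsupp : ∀ q, z q ≠ 0 → ∃ l, q = Sum.inl (r l, l) := by
    intro q hq
    have : q ∈ Finset.univ.filter fun q => z q ≠ 0 := by simpa using hq
    rw [← himg] at this
    obtain ⟨l, -, rfl⟩ := Finset.mem_image.1 this
    exact ⟨l, rfl⟩
  have hvert : ∀ i j, vert z i j = 0 := by
    intro i j
    rw [vert]
    split_ifs
    · by_contra h0
      obtain ⟨l, hl⟩ := hsupp _ h0
      cases hl
    · rfl
  -- Without vertical edges, a cycle that enters a site from the left must leave it to the right in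
  -- the same row.
  have hsucc : ∀ c (hc : c + 1 < d), r ⟨c + 1, hc⟩ = r ⟨c, by omega⟩ := by
    intro c hc
    have hb := boundary_eq z (r ⟨c, by omega⟩, ⟨c, by omega⟩)
    simp only [hz, hvert, Pi.zero_apply, add_zero, ite_self] at hb
    have h1 := hr ⟨c, by omega⟩
    rw [← horiz_val z] at h1
    have h2 : horiz z (r ⟨c, by omega⟩) (c + 1) ≠ 0 := by
      rwa [← zmod_two_add_eq_zero.1 hb.symm]
    rw [horiz, dif_pos ⟨Fin.isLt _, hc⟩] at h2
    obtain ⟨l, hl⟩ := hsupp _ h2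
    simp only [Sum.inl.injEq, Prod.mk.injEq, Fin.eta] at hl
    rw [hl.1, hl.2]
  have hconst : ∀ c (hc : c < d), r ⟨c, hc⟩ = r ⟨0, by omega⟩ := by
    intro c
    induction c with
    | zero => exact fun _ => rfl
    | succ c ih => exact fun hc => (hsucc c hc).trans (ih _)
  refine ⟨r ⟨0, k.pos⟩, fun q hq => ?_⟩
  obtain ⟨l, rfl⟩ := hsupp q hq
  exact ⟨l, by rw [← hconst l l.2]⟩

/-- A cycle that is confined to a row and crosses the columns evenly vanishes. -/
theorem eq_zero_of_row (z : Chain d) (r : Fin d) (hr : ∀ q, z q ≠ 0 → ∃ c, q = Sum.inl (r, c))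
    (hc : ∀ k, columnParity k z = 0) : z = 0 := by
  funext q
  by_contra hq
  obtain ⟨c, rfl⟩ := hr q hq
  have := hc c
  rw [columnParity_apply, Finset.sum_eq_single r] at this
  · exact hq this
  · intro b _ hb
    by_contra h
    obtain ⟨l, hl⟩ := hr _ h
    simp only [Sum.inl.injEq, Prod.mk.injEq] at hl
    exact hb hl.1
  · simp

/-! ### The stabilizer code -/

/-- The `Z` part of a Pauli pattern, a chain of the primal lattice. -/
def zPart : PauliPattern (Qubit d) →ₗ[ZMod 2] Chain d where
  toFun E q := (E q).2
  map_add' _ _ := rfl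
  map_smul' _ _ := rfl

/-- The `X` part of a Pauli pattern, reflected to a chain of the primal lattice. -/
def xPart : PauliPattern (Qubit d) →ₗ[ZMod 2] Chain d where
  toFun E q := (E (transpose q)).1
  map_add' _ _ := rfl
  map_smul' _ _ := rfl

/-- The Pauli pattern with `Z` on the edges of a chain. -/
def ofZ : Chain d →ₗ[ZMod 2] PauliPattern (Qubit d) where
  toFun z q := (0, z q)
  map_add' _ _ := by funext q; simp
  map_smul' _ _ := by funext q; simp

/-- The Pauli pattern with `X` on the reflected edges of a chain. -/
def ofX : Chain d →ₗ[ZMod 2] PauliPattern (Qubit d) where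
  toFun x q := (x (transpose q), 0)
  map_add' _ _ := by funext q; simp
  map_smul' _ _ := by funext q; simp

theorem ofX_add_ofZ (E : PauliPattern (Qubit d)) : ofX (xPart E) + ofZ (zPart E) = E := by
  funext q
  simp [ofX, ofZ, xPart, zPart, transpose_transpose]

theorem zPart_ofZ (z : Chain d) : zPart (ofZ z) = z := rfl

theorem xPart_ofZ (z : Chain d) : xPart (ofZ z) = 0 := rfl

theorem zPart_site (v : Site d) : zPart (generator d (Sum.inl v)) = 0 := rfl

theorem xPart_site (v : Site d) : xPart (generator d (Sum.inl v)) = border (v.2, v.1) :=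
  funext fun q => star_transpose v q

theorem zPart_plaquette (p : Plaquette d) : zPart (generator d (Sum.inr p)) = border p := rfl

theorem xPart_plaquette (p : Plaquette d) : xPart (generator d (Sum.inr p)) = 0 := rfl

theorem ofZ_border (p : Plaquette d) : ofZ (border p) = generator d (Sum.inr p) := rfl

theorem ofX_border (p : Plaquette d) : ofX (border p) = generator d (Sum.inl (p.2, p.1)) := by
  funext q
  refine Prod.ext ?_ rfl
  change border p (transpose q) = star (p.2, p.1) q
  rw [← star_transpose (p.2, p.1), transpose_transpose]

theorem symp_site (v : Site d) (E : PauliPattern (Qubit d)) :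
    (generator d (Sum.inl v)).symp E = boundary (zPart E) v := by
  simp [PauliPattern.symp, generator, boundary_apply, zPart]

/-- The reflection of the lattice as a permutation of the qubits. -/
def transposeEquiv : Qubit d ≃ Qubit d := ⟨transpose, transpose, transpose_transpose, transpose_transpose⟩

theorem symp_plaquette (p : Plaquette d) (E : PauliPattern (Qubit d)) :
    (generator d (Sum.inr p)).symp E = boundary (xPart E) (p.2, p.1) := by
  rw [boundary_apply, ← (transposeEquiv (d := d)).sum_comp]
  simp only [PauliPattern.symp, generator, zero_mul, zero_add]
  refine Finset.sum_congr rfl fun q _ => ?_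
  change border p q * (E q).1 = star (p.2, p.1) (transpose q) * (E (transpose (transpose q))).1
  rw [star_transpose, transpose_transpose]

/-- The generators are purely `X` or purely `Z`, and the reflection turns stars into borders, so
both parts are tested against the same span. -/
theorem mem_stabilizer_iff (E : PauliPattern (Qubit d)) :
    E ∈ stabilizerOf (generator d) ↔ zPart E ∈ bordersSpan d ∧ xPart E ∈ bordersSpan d := by
  constructor
  · intro hE
    have : stabilizerOf (generator d)
        ≤ (bordersSpan d).comap zPart ⊓ (bordersSpan d).comap xPart := by
      rw [stabilizerOf, Submodule.span_le]
      rintro _ ⟨v | p, rfl⟩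
      · refine ⟨?_, ?_⟩ <;> rw [SetLike.mem_coe, Submodule.mem_comap]
        · rw [zPart_site]; exact Submodule.zero_mem _
        · rw [xPart_site]; exact Submodule.subset_span ⟨_, rfl⟩
      · refine ⟨?_, ?_⟩ <;> rw [SetLike.mem_coe, Submodule.mem_comap]
        · rw [zPart_plaquette]; exact Submodule.subset_span ⟨_, rfl⟩
        · rw [xPart_plaquette]; exact Submodule.zero_mem _
    exact this hE
  · rintro ⟨hz, hx⟩
    have h1 : bordersSpan d ≤ (stabilizerOf (generator d)).comap ofZ := by
      rw [bordersSpan, Submodule.span_le]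
      rintro _ ⟨p, rfl⟩
      exact Submodule.subset_span ⟨_, (ofZ_border p).symm⟩
    have h2 : bordersSpan d ≤ (stabilizerOf (generator d)).comap ofX := by
      rw [bordersSpan, Submodule.span_le]
      rintro _ ⟨p, rfl⟩
      exact Submodule.subset_span ⟨_, (ofX_border p).symm⟩
    rw [← ofX_add_ofZ E]
    exact Submodule.add_mem _ (h2 hx) (h1 hz)

theorem weight_zPart_le (E : PauliPattern (Qubit d)) : (zPart E).weight ≤ E.weight := by
  refine Finset.card_le_card (Finset.monotone_filter_right _ fun q _ hq h => hq ?_)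
  change (E q).2 = 0
  rw [h]; rfl

theorem weight_xPart_le (E : PauliPattern (Qubit d)) : (xPart E).weight ≤ E.weight := by
  refine Finset.card_le_card_of_injOn transpose ?_ (transposeEquiv (d := d)).injective.injOn
  intro q hq
  simp only [Finset.coe_filter, Finset.mem_univ, true_and, Set.mem_ofPred_eq] at hq ⊢
  intro h
  apply hq
  change (E (transpose q)).1 = 0
  rw [h]; rfl

theorem commute_generator (g h : GenLabel d) : (generator d g).symp (generator d h) = 0 := by
  rcases g with v | p
  · rw [symp_site]
    rcases h with w | p
    · rw [zPart_site, map_zero]; rfl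
    · rw [zPart_plaquette, boundary_border]; rfl
  · rw [symp_plaquette]
    rcases h with w | p
    · rw [xPart_site, boundary_border]; rfl
    · rw [xPart_plaquette, map_zero]; rfl

theorem linearIndependent_generator : LinearIndependent (ZMod 2) (generator d) := by
  rw [Fintype.linearIndependent_iff]
  intro a ha
  rw [Fintype.sum_sum_type] at ha
  rintro (v | p)
  · have h := congrArg xPart ha
    simp only [map_add, map_sum, map_smul, xPart_site, xPart_plaquette, smul_zero,
      Finset.sum_const_zero, add_zero, map_zero] at h
    have hli : LinearIndependent (ZMod 2) fun v : Site d => border (v.2, v.1) :=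
      linearIndependent_border.comp Prod.swap Prod.swap_injective
    exact Fintype.linearIndependent_iff.1 hli _ h v
  · have h := congrArg zPart ha
    simp only [map_add, map_sum, map_smul, zPart_site, zPart_plaquette, smul_zero,
      Finset.sum_const_zero, zero_add, map_zero] at h
    exact Fintype.linearIndependent_iff.1 linearIndependent_border _ h p

theorem boundary_zPart_of_isLogical {P : PauliPattern (Qubit d)}
    (hP : ∀ S ∈ stabilizerOf (generator d), PauliPattern.symp S P = 0) : boundary (zPart P) = 0 :=
  funext fun v => by
    rw [← symp_site]; exact hP _ (Submodule.subset_span ⟨_, rfl⟩)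

theorem boundary_xPart_of_isLogical {P : PauliPattern (Qubit d)}
    (hP : ∀ S ∈ stabilizerOf (generator d), PauliPattern.symp S P = 0) : boundary (xPart P) = 0 :=
  funext fun v => by
    have := symp_plaquette (v.2, v.1) P
    rw [← this]; exact hP _ (Submodule.subset_span ⟨_, rfl⟩)

theorem symp_eq_zero {P : PauliPattern (Qubit d)} (hz : boundary (zPart P) = 0)
    (hx : boundary (xPart P) = 0) :
    ∀ S ∈ stabilizerOf (generator d), PauliPattern.symp S P = 0 := by
  intro S hS
  induction hS using Submodule.span_induction with
  | mem S h =>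
    obtain ⟨v | p, rfl⟩ := h
    · rw [symp_site, hz]; rfl
    · rw [symp_plaquette, hx]; rfl
  | zero => simp [PauliPattern.symp]
  | add S T _ _ hS hT =>
    have : (S + T).symp P = S.symp P + T.symp P := by
      simp only [PauliPattern.symp, ← Finset.sum_add_distrib, Pi.add_apply, Prod.fst_add,
        Prod.snd_add]
      exact Finset.sum_congr rfl fun q _ => by ring
    rw [this, hS, hT, add_zero]
  | smul a S _ hS =>
    have : (a • S).symp P = a * S.symp P := by
      simp only [PauliPattern.symp, Finset.mul_sum, Pi.smul_apply, Prod.smul_fst, Prod.smul_snd,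
        smul_eq_mul]
      exact Finset.sum_congr rfl fun q _ => by ring
    rw [this, hS, mul_zero]

/-- The horizontal edges of the first row. -/
def firstRow (d : ℕ) : Chain d
  | Sum.inl (r, _) => if r.val = 0 then 1 else 0
  | Sum.inr _ => 0

theorem boundary_firstRow : boundary (firstRow d) = 0 := by
  funext v
  obtain ⟨⟨i, hi⟩, ⟨j, hj⟩⟩ := v
  rw [boundary_eq]
  simp only [horiz, vert, firstRow, Pi.zero_apply]
  split_ifs <;> first | omega | rfl

theorem columnParity_firstRow (hd : 1 ≤ d) (k : Fin d) : columnParity k (firstRow d) = 1 := by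
  rw [columnParity_apply, Finset.sum_eq_single ⟨0, hd⟩]
  · rfl
  · intro r _ hr
    simpa [firstRow, Fin.ext_iff] using hr
  · simp

theorem weight_firstRow (hd : 1 ≤ d) : (ofZ (firstRow d)).weight = d := by
  have : (Finset.univ.filter fun q => ofZ (firstRow d) q ≠ 0)
      = Finset.univ.image fun c : Fin d => (Sum.inl (⟨0, hd⟩, c) : Qubit d) := by
    ext q
    rcases q with ⟨r, c⟩ | q <;> simp [ofZ, firstRow, Fin.ext_iff, Prod.ext_iff, eq_comm (a := 0)]
  rw [PauliPattern.weight, this, Finset.card_image_of_injective, Finset.card_univ, Fintype.card_fin]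
  intro a b h
  simpa using h

theorem isStabilizerCode (hd : 1 ≤ d) :
    IsStabilizerCode (generator d) (d ^ 2 + (d - 1) ^ 2) 1 d where
  card_qubits := by simp [sq]
  commute := commute_generator
  independent := linearIndependent_generator
  card_generators := by
    obtain ⟨n, rfl⟩ : ∃ n, d = n + 1 := ⟨d - 1, by omega⟩
    simp only [Fintype.card_sum, Fintype.card_prod, Fintype.card_fin, Nat.add_sub_cancel]
    ring
  distance := by
    constructor
    · refine ⟨ofZ (firstRow d), ⟨symp_eq_zero ?_ ?_, fun h => ?_⟩, weight_firstRow hd⟩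
      · rw [zPart_ofZ, boundary_firstRow]
      · rw [xPart_ofZ, map_zero]
      · rw [mem_stabilizer_iff, zPart_ofZ] at h
        have := columnParity_of_mem_bordersSpan h.1 ⟨0, hd⟩
        rw [columnParity_firstRow hd] at this
        exact one_ne_zero this
    · rintro _ ⟨P, ⟨hP, hns⟩, rfl⟩
      by_contra! hlt
      refine hns ((mem_stabilizer_iff P).2 ⟨?_, ?_⟩)
      · exact mem_bordersSpan_of_weight_lt _ (boundary_zPart_of_isLogical hP)
          ((weight_zPart_le P).trans_lt hlt)
      · exact mem_bordersSpan_of_weight_lt _ (boundary_xPart_of_isLogical hP)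
          ((weight_xPart_le P).trans_lt hlt)

/-! ### Bubble clustering -/

theorem manhattan_comm (u v : Site d) : manhattan u v = manhattan v u := by
  unfold manhattan; omega

theorem bubble_perm (R : ℤ) (u : Site d) (l : List (Site d)) :
    (inBubble R u l ++ outBubble R u l).Perm l :=
  List.filter_append_perm _ _

theorem mem_inBubble {R : ℤ} {u v : Site d} {l : List (Site d)} :
    v ∈ inBubble R u l ↔ v ∈ l ∧ (manhattan u v : ℤ) ≤ R := by
  simp [inBubble]

theorem mem_outBubble {R : ℤ} {u v : Site d} {l : List (Site d)} :
    v ∈ outBubble R u l ↔ v ∈ l ∧ R < (manhattan u v : ℤ) := by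
  simp [outBubble]

theorem growCluster_perm (R : ℤ) (queue rest : List (Site d)) :
    ((growCluster R queue rest).1 ++ (growCluster R queue rest).2.2).Perm (queue ++ rest) := by
  fun_induction growCluster R queue rest with
  | case1 rest => exact List.Perm.refl _
  | case2 cur queue rest out ih =>
    refine List.Perm.cons cur (ih.trans ?_)
    rw [List.append_assoc]
    exact (bubble_perm R cur rest).append_left queue

theorem growCluster_rest_subset (R : ℤ) (queue rest : List (Site d)) :
    (growCluster R queue rest).2.2 ⊆ rest := by
  change ∀ x ∈ (growCluster R queue rest).2.2, x ∈ rest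
  fun_induction growCluster R queue rest with
  | case1 rest => exact fun x hx => hx
  | case2 cur queue rest out ih =>
    exact fun x hx => (mem_outBubble.1 (ih x hx)).1

theorem subset_growCluster (R : ℤ) (queue rest : List (Site d)) :
    queue ⊆ (growCluster R queue rest).1 := by
  change ∀ x ∈ queue, x ∈ (growCluster R queue rest).1
  fun_induction growCluster R queue rest with
  | case1 rest => exact fun x hx => hx
  | case2 cur queue rest out ih =>
    intro x hx
    rcases List.mem_cons.1 hx with rfl | hx
    · exact List.mem_cons_self
    · exact List.mem_cons_of_mem _ (ih x (List.mem_append_left _ hx))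

theorem growCluster_separated (R : ℤ) (queue rest : List (Site d)) :
    ∀ x ∈ (growCluster R queue rest).1, ∀ y ∈ (growCluster R queue rest).2.2,
      R < (manhattan x y : ℤ) := by
  fun_induction growCluster R queue rest with
  | case1 rest => intro x hx; simp at hx
  | case2 cur queue rest out ih =>
    intro x hx y hy
    rcases List.mem_cons.1 hx with rfl | hx
    · exact (mem_outBubble.1 (growCluster_rest_subset _ _ _ hy)).2
    · exact ih x hx y hy

theorem growCluster_edges (R : ℤ) (queue rest : List (Site d)) (h : (queue ++ rest).Nodup) :
    ∀ e ∈ (growCluster R queue rest).2.1, e.1 ∈ (growCluster R queue rest).1 ∧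
      e.2 ∈ (growCluster R queue rest).1 ∧ e.1 ≠ e.2 := by
  fun_induction growCluster R queue rest with
  | case1 rest => intro e he; simp at he
  | case2 cur queue rest out ih =>
    intro e he
    rcases List.mem_append.1 he with he | he
    · obtain ⟨x, hx, rfl⟩ := List.mem_map.1 he
      refine ⟨List.mem_cons_self, List.mem_cons_of_mem _
        (subset_growCluster _ _ _ (List.mem_append_right _ hx)), ?_⟩
      rintro (rfl : cur = x)
      rw [List.cons_append, List.nodup_cons] at h
      exact h.1 (List.mem_append_right _ (mem_inBubble.1 hx).1)
    · have hn : ((queue ++ inBubble R cur rest) ++ outBubble R cur rest).Nodup := by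
        rw [List.append_assoc, ((bubble_perm R cur rest).append_left queue).nodup_iff]
        exact (List.nodup_cons.1 h).2
      obtain ⟨h1, h2, h3⟩ := ih hn e he
      exact ⟨List.mem_cons_of_mem _ h1, List.mem_cons_of_mem _ h2, h3⟩

/-- Connectedness is phrased as the constancy of any predicate that is preserved along edges. A
newly reached defect inherits its value from the defect being processed, so everything goes back to
the initial queue. -/
theorem growCluster_connected (R : ℤ) (queue rest : List (Site d)) (f : Site d → Prop)
    (hf : ∀ e ∈ (growCluster R queue rest).2.1, f e.1 = f e.2) :
    ∀ x ∈ (growCluster R queue rest).1, ∃ q ∈ queue, f x = f q := by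
  fun_induction growCluster R queue rest with
  | case1 rest => intro x hx; simp at hx
  | case2 cur queue rest out ih =>
    intro x hx
    rcases List.mem_cons.1 hx with rfl | hx
    · exact ⟨x, List.mem_cons_self, rfl⟩
    · obtain ⟨q, hq, hxq⟩ := ih (fun e he => hf e (List.mem_append_right _ he)) x hx
      rcases List.mem_append.1 hq with hq | hq
      · exact ⟨q, List.mem_cons_of_mem _ hq, hxq⟩
      · exact ⟨cur, List.mem_cons_self,
          hxq.trans (hf (cur, q) (List.mem_append_left _ (List.mem_map_of_mem hq))).symm⟩

/-- Every defect outside the initial queue joins with exactly one edge. -/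
theorem growCluster_length (R : ℤ) (queue rest : List (Site d)) :
    (growCluster R queue rest).2.1.length + queue.length
      = (growCluster R queue rest).1.length := by
  fun_induction growCluster R queue rest with
  | case1 rest => rfl
  | case2 cur queue rest out ih =>
    change out.2.1.length + _ = out.1.length at ih
    simp only [List.length_append, List.length_map, List.length_cons] at ih ⊢
    omega

/-- The edges `T` form a tree on the vertices `V`. -/
structure IsTreeOn (V : Finset (Site d)) (T : List (Site d × Site d)) : Prop where
  fst_mem : ∀ e ∈ T, e.1 ∈ V
  snd_mem : ∀ e ∈ T, e.2 ∈ V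
  ne : ∀ e ∈ T, e.1 ≠ e.2
  connected : ∀ f : Site d → Prop, (∀ e ∈ T, f e.1 = f e.2) → ∀ x ∈ V, ∀ y ∈ V, f x = f y
  card : V.card = T.length + 1

theorem growCluster_isTreeOn (R : ℤ) (v : Site d) (rest : List (Site d)) (h : (v :: rest).Nodup) :
    IsTreeOn (growCluster R [v] rest).1.toFinset (growCluster R [v] rest).2.1 := by
  have hn : (growCluster R [v] rest).1.Nodup :=
    (((growCluster_perm R [v] rest).nodup_iff).2 h).of_append_left
  refine ⟨fun e he => ?_, fun e he => ?_, fun e he => ?_, fun f hf x hx y hy => ?_, ?_⟩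
  · exact List.mem_toFinset.2 (growCluster_edges R [v] rest h e he).1
  · exact List.mem_toFinset.2 (growCluster_edges R [v] rest h e he).2.1
  · exact (growCluster_edges R [v] rest h e he).2.2
  · obtain ⟨q, hq, h1⟩ := growCluster_connected R [v] rest f hf x (List.mem_toFinset.1 hx)
    obtain ⟨q', hq', h2⟩ := growCluster_connected R [v] rest f hf y (List.mem_toFinset.1 hy)
    rw [List.mem_singleton] at hq hq'
    rw [h1, h2, hq, hq']
  · rw [List.toFinset_card_of_nodup hn, ← growCluster_length]
    rfl

theorem clusters_subset (R : ℤ) (l : List (Site d)) :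
    ∀ C ∈ clusters R l, C.members ⊆ l := by
  fun_induction clusters R l with
  | case1 => intro C hC; simp at hC
  | case2 v rest ih =>
    intro C hC x hx
    rcases List.mem_cons.1 hC with rfl | hC
    · exact (growCluster_perm R [v] rest).subset (List.mem_append_left _ hx)
    · exact List.mem_cons_of_mem _ (growCluster_rest_subset _ _ _ (ih C hC hx))

theorem clusters_isTreeOn (R : ℤ) (l : List (Site d)) (h : l.Nodup) :
    ∀ C ∈ clusters R l, C.members ≠ [] ∧ C.members.Nodup ∧
      IsTreeOn C.members.toFinset C.tree := by
  fun_induction clusters R l with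
  | case1 => intro C hC; simp at hC
  | case2 v rest ih =>
    intro C hC
    have hn := ((growCluster_perm R [v] rest).nodup_iff).2 h
    rcases List.mem_cons.1 hC with rfl | hC
    · exact ⟨List.ne_nil_of_mem (subset_growCluster R [v] rest List.mem_cons_self),
        hn.of_append_left, growCluster_isTreeOn R v rest h⟩
    · exact ih hn.of_append_right C hC

theorem clusters_separated (R : ℤ) (l : List (Site d)) :
    ∀ C ∈ clusters R l, ∀ x ∈ C.members, ∀ y ∈ l, y ∉ C.members → R < (manhattan x y : ℤ) := by
  fun_induction clusters R l with
  | case1 => intro C hC; simp at hC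
  | case2 v rest ih =>
    intro C hC x hx y hy hyC
    have hy' := (growCluster_perm R [v] rest).symm.subset hy
    rcases List.mem_cons.1 hC with rfl | hC
    · rcases List.mem_append.1 hy' with hy' | hy'
      · exact absurd hy' hyC
      · exact growCluster_separated R [v] rest x hx y hy'
    · rcases List.mem_append.1 hy' with hy' | hy'
      · rw [manhattan_comm]
        exact growCluster_separated R [v] rest y hy' x (clusters_subset R _ C hC hx)
      · exact ih C hC x hx y hy' hyC

/-- The clusters partition the defects; in this form the syndromes of the pieces of the error add up
to the whole syndrome. -/
theorem clusters_sum (R : ℤ) (l : List (Site d)) (h : l.Nodup) (v : Site d) :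
    ((clusters R l).map fun C => if v ∈ C.members then (1 : ZMod 2) else 0).sum
      = if v ∈ l then 1 else 0 := by
  fun_induction clusters R l with
  | case1 => simp
  | case2 w rest ih =>
    have hp := growCluster_perm R [w] rest
    have hn := (hp.nodup_iff).2 h
    have hm : v ∈ w :: rest ↔ v ∈ (growCluster R [w] rest).1 ∨ v ∈ (growCluster R [w] rest).2.2 := by
      rw [← List.mem_append]; exact hp.symm.mem_iff
    have hd := List.disjoint_of_nodup_append hn
    rw [List.map_cons, List.sum_cons, ih hn.of_append_right]
    simp only [hm]
    by_cases h1 : v ∈ (growCluster R [w] rest).1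
    · have h2 : v ∉ (growCluster R [w] rest).2.2 := fun h2 => hd h1 h2
      simp [h1, h2]
    · simp [h1]

theorem nodup_allSites : (allSites d).Nodup :=
  (List.nodup_finRange d).product (List.nodup_finRange (d - 1))

theorem mem_allSites (v : Site d) : v ∈ allSites d :=
  List.pair_mem_product.2 ⟨List.mem_finRange _, List.mem_finRange _⟩

theorem nodup_defects (s : Site d → ZMod 2) : (defects s).Nodup := nodup_allSites.filter _

theorem mem_defects {s : Site d → ZMod 2} {v : Site d} : v ∈ defects s ↔ s v = 1 := by
  simp [defects, mem_allSites]

theorem length_defects (s : Site d → ZMod 2) :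
    (defects s).length = (Finset.univ.filter fun v => s v ≠ 0).card := by
  rw [← List.toFinset_card_of_nodup (nodup_defects s)]
  congr 1
  ext v
  simp [mem_defects, zmod_two_ne_zero]

/-! ### Peeling -/

theorem interval_boundary (a b c : ℕ) :
    (if min a b < c ∧ c ≤ max a b then 1 else 0) + (if min a b < c + 1 ∧ c + 1 ≤ max a b then 1 else 0)
      = ((if c = a then 1 else 0) + (if c = b then 1 else 0) : ZMod 2) := by
  split_ifs <;> first | omega | decide

/-- The vertical and the horizontal segment each contribute their two ends, and the common corner
cancels. -/
theorem boundary_buildMatch (u v : Site d) :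
    boundary (buildMatch u v) = Pi.single u 1 + Pi.single v 1 := by
  funext w
  obtain ⟨⟨a, ha⟩, ⟨b, hb⟩⟩ := u
  obtain ⟨⟨i, hi⟩, ⟨j, hj⟩⟩ := v
  obtain ⟨⟨r, hr⟩, ⟨c, hc⟩⟩ := w
  have h1 : ∀ m, m < d → horiz (buildMatch (⟨a, ha⟩, ⟨b, hb⟩) (⟨i, hi⟩, ⟨j, hj⟩)) r m
      = if r = i then (if min b j < m ∧ m ≤ max b j then 1 else 0) else 0 := by
    intro m hm
    simp only [horiz, buildMatch, Fin.mk.injEq]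
    rw [dif_pos ⟨hr, hm⟩, ite_and]
  have h2 : ∀ m, vert (buildMatch (⟨a, ha⟩, ⟨b, hb⟩) (⟨i, hi⟩, ⟨j, hj⟩)) m c
      = if c = b then (if min a i < m + 1 ∧ m + 1 ≤ max a i then 1 else 0) else 0 := by
    intro m
    simp only [vert, buildMatch, Fin.mk.injEq]
    split_ifs <;> first | omega | rfl
  have h3 : (if 0 < r then vert (buildMatch (⟨a, ha⟩, ⟨b, hb⟩) (⟨i, hi⟩, ⟨j, hj⟩)) (r - 1) c else 0)
      = if c = b then (if min a i < r ∧ r ≤ max a i then 1 else 0) else 0 := by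
    rw [h2]
    split_ifs <;> first | omega | rfl
  have k1 := interval_boundary b j c
  have k2 := interval_boundary a i r
  rw [boundary_eq]
  simp only [h3]
  simp only [h1 c (by omega), h1 (c + 1) (by omega), h2]
  have e1 : (if r = i then (if min b j < c ∧ c ≤ max b j then 1 else 0) else 0)
      + (if r = i then (if min b j < c + 1 ∧ c + 1 ≤ max b j then 1 else 0) else 0)
      = (if r = i then (if c = b then 1 else 0) + (if c = j then 1 else 0) else 0 : ZMod 2) := by
    rw [← k1]; split_ifs <;> simp
  have e2 : (if c = b then (if min a i < r + 1 ∧ r + 1 ≤ max a i then 1 else 0) else 0)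
      + (if c = b then (if min a i < r ∧ r ≤ max a i then 1 else 0) else 0)
      = (if c = b then (if r = a then 1 else 0) + (if r = i then 1 else 0) else 0 : ZMod 2) := by
    rw [← k2]; split_ifs <;> simp
  rw [e1, add_assoc, e2]
  simp only [Pi.add_apply, Pi.single_apply, Prod.mk.injEq, Fin.mk.injEq]
  clear k1 k2 e1 e2 h1 h2 h3
  split_ifs <;> first | omega | decide

theorem boundary_buildGhostMatch (g : Site d × Side) :
    boundary (buildGhostMatch g) = Pi.single g.1 1 := by
  funext w
  obtain ⟨⟨⟨i, hi⟩, ⟨j, hj⟩⟩, b⟩ := g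
  obtain ⟨⟨r, hr⟩, ⟨c, hc⟩⟩ := w
  rw [boundary_eq]
  simp only [Pi.single_apply, Prod.mk.injEq, Fin.mk.injEq]
  cases b <;> simp only [horiz, vert, buildGhostMatch, Fin.mk.injEq] <;>
    split_ifs <;> first | omega | rfl

/-- The chains spanned by the paths between the sites of a list. -/
def pathSpan (M : List (Site d)) : Submodule (ZMod 2) (Chain d) :=
  Submodule.span (ZMod 2) {z | ∃ u ∈ M, ∃ v ∈ M, z = buildMatch u v}

/-- The edges of a tree that are incident to a site. -/
def incident (u : Site d) (T : List (Site d × Site d)) : List (Site d × Site d) :=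
  T.filter fun e => e.1 = u ∨ e.2 = u

theorem mem_incident {u : Site d} {T : List (Site d × Site d)} {e : Site d × Site d} :
    e ∈ incident u T ↔ e ∈ T ∧ (e.1 = u ∨ e.2 = u) := by
  simp [incident]

theorem sum_length_incident (V : Finset (Site d)) (T : List (Site d × Site d))
    (h1 : ∀ e ∈ T, e.1 ∈ V) (h2 : ∀ e ∈ T, e.2 ∈ V) (hne : ∀ e ∈ T, e.1 ≠ e.2) :
    ∑ u ∈ V, (incident u T).length = 2 * T.length := by
  induction T with
  | nil => simp [incident]
  | cons e T ih =>
    have hs : ∀ u, (incident u (e :: T)).length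
        = (incident u T).length + ((if e.1 = u then 1 else 0) + (if e.2 = u then 1 else 0)) := by
      intro u
      have hn := hne e List.mem_cons_self
      by_cases a : e.1 = u
      · have b : e.2 ≠ u := fun b => hn (a.trans b.symm)
        simp [incident, a, b]
      · by_cases b : e.2 = u <;> simp [incident, a, b]
    simp only [hs, Finset.sum_add_distrib, Finset.sum_ite_eq, h1 e List.mem_cons_self,
      h2 e List.mem_cons_self, if_true, List.length_cons]
    rw [ih (fun e he => h1 e (List.mem_cons_of_mem _ he)) (fun e he => h2 e (List.mem_cons_of_mem _ he))
      (fun e he => hne e (List.mem_cons_of_mem _ he))]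
    ring

/-- If all degrees were at least 2, the handshake count `2 * T.length` would be at least twice the
number of vertices, which exceeds `T.length` by one. Degree 0 is excluded by connectedness. -/
theorem IsTreeOn.exists_leaf {V : Finset (Site d)} {T : List (Site d × Site d)}
    (h : IsTreeOn V T) (hT : T ≠ []) : ∃ u ∈ V, (incident u T).length = 1 := by
  by_contra! hno
  have hcard := h.card
  have hpos := List.length_pos_iff.2 hT
  have h2 : ∀ u ∈ V, 2 ≤ (incident u T).length := by
    intro u hu
    have h0 : (incident u T).length ≠ 0 := by
      intro h0
      rw [List.length_eq_zero_iff] at h0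
      obtain ⟨y, hy, hyu⟩ := Finset.exists_mem_ne (show 1 < V.card by omega) u
      -- No edge touches an isolated `u`, so the predicate "equal to `u`" is constant along the
      -- edges and would have to hold everywhere.
      have hf : ∀ e ∈ T, (e.1 = u) = (e.2 = u) := by
        intro e he
        have hi : e ∉ incident u T := by rw [h0]; exact List.not_mem_nil
        rw [mem_incident] at hi
        push Not at hi
        obtain ⟨a, b⟩ := hi he
        exact propext ⟨fun c => absurd c a, fun c => absurd c b⟩
      have := h.connected (fun x => x = u) hf u hu y hy
      exact hyu (this ▸ rfl)
    have := hno u hu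
    omega
  have := Finset.card_nsmul_le_sum V (fun u => (incident u T).length) 2 h2
  rw [sum_length_incident V T h.fst_mem h.snd_mem h.ne, smul_eq_mul] at this
  omega

/-- The other end of the edge `e`, seen from `u`. -/
def otherEnd (u : Site d) (e : Site d × Site d) : Site d := if e.1 = u then e.2 else e.1

theorem IsTreeOn.erase_leaf {V : Finset (Site d)} {T : List (Site d × Site d)}
    (h : IsTreeOn V T) {u : Site d} {e : Site d × Site d} (he : incident u T = [e]) :
    u ∈ V ∧ otherEnd u e ∈ V ∧ otherEnd u e ≠ u ∧ IsTreeOn (V.erase u) (T.erase e) := by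
  have hmem : e ∈ incident u T := by rw [he]; exact List.mem_singleton_self e
  obtain ⟨heT, heu⟩ := mem_incident.1 hmem
  have hp := List.perm_cons_erase heT
  have hrest : ∀ e' ∈ T.erase e, e'.1 ≠ u ∧ e'.2 ≠ u := by
    intro e' he'
    have hl := (hp.filter fun e => decide (e.1 = u ∨ e.2 = u)).length_eq
    have hl0 : (incident u T).length = 1 := by rw [he]; rfl
    rw [← incident, hl0, List.filter_cons_of_pos (by simpa using heu), List.length_cons] at hl
    have h0 : incident u (T.erase e) = [] := List.length_eq_zero_iff.1 (by unfold incident; omega)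
    have hi : e' ∉ incident u (T.erase e) := by rw [h0]; exact List.not_mem_nil
    rw [mem_incident] at hi
    push Not at hi
    exact hi he'
  have hne := h.ne e heT
  have huV : u ∈ V := by
    rcases heu with rfl | rfl
    · exact h.fst_mem e heT
    · exact h.snd_mem e heT
  have hoV : otherEnd u e ∈ V := by
    unfold otherEnd
    split_ifs
    · exact h.snd_mem e heT
    · exact h.fst_mem e heT
  have hou : otherEnd u e ≠ u := by
    unfold otherEnd
    split_ifs with h1
    · rw [← h1]; exact hne.symm
    · exact h1
  refine ⟨huV, hoV, hou, ?_⟩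
  have hsub : ∀ e' ∈ T.erase e, e' ∈ T := fun e' he' => List.mem_of_mem_erase he'
  refine ⟨fun e' he' => ?_, fun e' he' => ?_, fun e' he' => h.ne e' (hsub e' he'),
    fun f hf x hx y hy => ?_, ?_⟩
  · exact Finset.mem_erase.2 ⟨(hrest e' he').1, h.fst_mem e' (hsub e' he')⟩
  · exact Finset.mem_erase.2 ⟨(hrest e' he').2, h.snd_mem e' (hsub e' he')⟩
  · obtain ⟨hxu, hx⟩ := Finset.mem_erase.1 hx
    obtain ⟨hyu, hy⟩ := Finset.mem_erase.1 hy
    -- The predicate is extended to the removed leaf by its value at the other end, so that it is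
    -- also preserved along the removed edge.
    have key := h.connected (fun z => if z = u then f (otherEnd u e) else f z) (fun e' he' => ?_)
      x hx y hy
    · simpa only [if_neg hxu, if_neg hyu] using key
    · rcases List.mem_cons.1 (hp.subset he') with rfl | he'
      · unfold otherEnd
        by_cases h1 : e'.1 = u
        · have h2 : e'.2 ≠ u := fun h2 => hne (h1.trans h2.symm)
          simp only [h1, if_true, if_neg h2]
        · simp only [if_neg h1, heu.resolve_left h1, if_true]
      · simp only [if_neg (hrest e' he').1, if_neg (hrest e' he').2]
        exact hf e' he'
  · rw [Finset.card_erase_of_mem huV, List.length_erase_of_mem heT, h.card]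
    have := List.length_pos_of_mem heT
    omega

/-- What holds throughout the peeling: `V` contains the vertices that have not been peeled yet. -/
structure PeelInvariant (M : List (Site d)) (s : Site d → ZMod 2) (c : Chain d)
    (V : Finset (Site d)) (st : PeelState d) : Prop where
  tree : IsTreeOn V st.tree
  subset : V ⊆ M.toFinset
  on_eq_zero : ∀ v ∉ V, st.on v = 0
  sum_on : ∑ v, st.on v = 0
  boundary_add : boundary st.chain + st.on = s
  chain_add_mem : st.chain + c ∈ pathSpan M

theorem peelVertex_of_incident {st : PeelState d} {u : Site d} {e : Site d × Site d}
    (he : incident u st.tree = [e]) :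
    peelVertex st u = if st.on u = 1 then
      { on := fun x => if x = u then 0 else if x = otherEnd u e then 1 - st.on (otherEnd u e)
          else st.on x
        tree := st.tree.erase e
        chain := st.chain + buildMatch u (otherEnd u e) }
    else { st with tree := st.tree.erase e } := by
  unfold incident at he
  unfold peelVertex
  rw [he]
  rfl

theorem peelVertex_of_length_ne {st : PeelState d} {u : Site d}
    (he : (incident u st.tree).length ≠ 1) : peelVertex st u = st := by
  unfold incident at he
  unfold peelVertex
  split
  · rename_i e h
    rw [h] at he
    exact absurd rfl he
  · rfl

theorem PeelInvariant.peelVertex {M : List (Site d)} {s : Site d → ZMod 2} {c : Chain d}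
    {V : Finset (Site d)} {st : PeelState d} (h : PeelInvariant M s c V st) (u : Site d) :
    (∃ V', PeelInvariant M s c V' (peelVertex st u)) ∧
      (peelVertex st u).tree.length ≤ st.tree.length ∧
      ((incident u st.tree).length = 1 → (SurfaceCode.peelVertex st u).tree.length < st.tree.length) ∧
      ((incident u st.tree).length ≠ 1 → SurfaceCode.peelVertex st u = st) := by
  by_cases hl : (incident u st.tree).length = 1
  · obtain ⟨e, he⟩ := List.length_eq_one_iff.1 hl
    have heT : e ∈ st.tree := (mem_incident.1 (he ▸ List.mem_singleton_self e : e ∈ incident u st.tree)).1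
    have hpos := List.length_pos_of_mem heT
    obtain ⟨huV, hoV, hou, htree⟩ := h.tree.erase_leaf he
    have hlen : (SurfaceCode.peelVertex st u).tree.length + 1 = st.tree.length := by
      rw [peelVertex_of_incident he]
      split_ifs <;> simp only [List.length_erase_of_mem heT] <;> omega
    refine ⟨⟨V.erase u, ?_⟩, by omega, fun _ => by omega, fun h' => absurd hl h'⟩
    rw [peelVertex_of_incident he]
    by_cases hon : st.on u = 1
    · rw [if_pos hon]
      -- Peeling toggles exactly the ends of the path added to the matching; hence the sum of the
      -- syndrome of the matching and the defects still on is unchanged.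
      have hnew : (fun x => if x = u then 0 else if x = otherEnd u e then 1 - st.on (otherEnd u e)
          else st.on x) = st.on + (Pi.single u 1 + Pi.single (otherEnd u e) 1) := by
        funext x
        simp only [Pi.add_apply, Pi.single_apply]
        by_cases h1 : x = u
        · subst h1
          simp [hon, hou.symm, CharTwo.add_self_eq_zero]
        · by_cases h2 : x = otherEnd u e
          · rw [if_neg h1, if_pos h2, if_neg h1, if_pos h2, h2, CharTwo.sub_eq_add]
            ring
          · simp [h1, h2]
      refine ⟨htree, (Finset.erase_subset _ _).trans h.subset, fun v hv => ?_, ?_, ?_, ?_⟩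
      · rw [Finset.mem_erase] at hv
        push Not at hv
        by_cases h1 : v = u
        · simp [h1]
        · have h2 : v ≠ otherEnd u e := fun h2 => hv h1 (h2 ▸ hoV)
          simp only [if_neg h1, if_neg h2]
          exact h.on_eq_zero v (hv h1)
      · simp only [hnew, Pi.add_apply, Finset.sum_add_distrib, h.sum_on]
        simp [CharTwo.add_self_eq_zero]
      · simp only [hnew, map_add, boundary_buildMatch]
        rw [add_add_add_comm, add_self_zmod_two, add_zero, h.boundary_add]
      · simp only
        rw [add_right_comm]
        refine Submodule.add_mem _ h.chain_add_mem (Submodule.subset_span ?_)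
        exact ⟨u, List.mem_toFinset.1 (h.subset huV), _, List.mem_toFinset.1 (h.subset hoV), rfl⟩
    · rw [if_neg hon]
      refine ⟨htree, (Finset.erase_subset _ _).trans h.subset, fun v hv => ?_, h.sum_on,
        h.boundary_add, h.chain_add_mem⟩
      rw [Finset.mem_erase] at hv
      push Not at hv
      by_cases h1 : v = u
      · rw [h1]
        by_contra h0
        exact hon (zmod_two_ne_zero.1 h0)
      · exact h.on_eq_zero v (hv h1)
  · rw [peelVertex_of_length_ne hl]
    exact ⟨⟨V, h⟩, le_rfl, fun h' => absurd h' hl, fun _ => rfl⟩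

/-- The state stays unchanged until the sweep meets a vertex of degree one. So whatever the order,
if a leaf is present at the start, that leaf or an earlier one is peeled. -/
theorem PeelInvariant.sweep {M : List (Site d)} {s : Site d → ZMod 2} {c : Chain d}
    (L : List (Site d)) {V : Finset (Site d)} {st : PeelState d} (h : PeelInvariant M s c V st) :
    (∃ V', PeelInvariant M s c V' (L.foldl SurfaceCode.peelVertex st)) ∧
      (L.foldl SurfaceCode.peelVertex st).tree.length ≤ st.tree.length ∧
      ((∃ u ∈ L, (incident u st.tree).length = 1) →
        (L.foldl SurfaceCode.peelVertex st).tree.length < st.tree.length) := by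
  induction L generalizing V st with
  | nil => exact ⟨⟨V, h⟩, le_rfl, by simp⟩
  | cons a L ih =>
    obtain ⟨⟨V', h'⟩, hle, hlt, heq⟩ := h.peelVertex a
    obtain ⟨h1, h2, h3⟩ := ih h'
    rw [List.foldl_cons]
    refine ⟨h1, h2.trans hle, ?_⟩
    rintro ⟨u, hu, hleaf⟩
    by_cases ha : (incident a st.tree).length = 1
    · exact h2.trans_lt (hlt ha)
    · have hst := heq ha
      rcases List.mem_cons.1 hu with rfl | hu
      · exact absurd hleaf ha
      · rw [hst] at h3 ⊢
        exact h3 ⟨u, hu, hleaf⟩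

theorem PeelInvariant.iterate {M : List (Site d)} {s : Site d → ZMod 2} {c : Chain d}
    {L : List (Site d)} (hL : ∀ v ∈ M, v ∈ L) (n : ℕ) {V : Finset (Site d)} {st : PeelState d}
    (h : PeelInvariant M s c V st) :
    (∃ V', PeelInvariant M s c V' ((fun st => L.foldl SurfaceCode.peelVertex st)^[n] st)) ∧
      ((fun st => L.foldl SurfaceCode.peelVertex st)^[n] st).tree.length ≤ st.tree.length - n := by
  induction n with
  | zero => exact ⟨⟨V, h⟩, le_rfl⟩
  | succ n ih =>
    obtain ⟨⟨V', h'⟩, hlen⟩ := ih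
    rw [Function.iterate_succ_apply']
    obtain ⟨h1, h2, h3⟩ := h'.sweep L
    refine ⟨h1, ?_⟩
    by_cases h0 : ((fun st => L.foldl SurfaceCode.peelVertex st)^[n] st).tree = []
    · rw [h0, List.length_nil] at h2
      exact h2.trans (Nat.zero_le _)
    · obtain ⟨u, hu, hleaf⟩ := h'.tree.exists_leaf h0
      have := h3 ⟨u, hL u (List.mem_toFinset.1 (h'.subset hu)), hleaf⟩
      have hb : (L.foldl SurfaceCode.peelVertex
        ((fun st => L.foldl SurfaceCode.peelVertex st)^[n] st)).tree.length < st.tree.length - n := by omega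
      change (L.foldl SurfaceCode.peelVertex
        ((fun st => L.foldl SurfaceCode.peelVertex st)^[n] st)).tree.length ≤ _
      omega

/-- The indicator of the sites of a list. -/
def siteIndicator (M : List (Site d)) : Site d → ZMod 2 := fun v => if v ∈ M then 1 else 0

theorem boundary_sum_buildGhostMatch (ghosts : List (Site d × Side)) (v : Site d) :
    boundary (ghosts.map buildGhostMatch).sum v
      = ((ghosts.filter fun g => g.1 = v).length : ZMod 2) := by
  induction ghosts with
  | nil => simp
  | cons g ghosts ih =>
    rw [List.map_cons, List.sum_cons, map_add, Pi.add_apply, ih, boundary_buildGhostMatch]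
    by_cases h : g.1 = v
    · simp [h, add_comm]
    · simp [h, Ne.symm h]

theorem sum_length_filter (ghosts : List (Site d × Side)) :
    ∑ v, (ghosts.filter fun g => g.1 = v).length = ghosts.length := by
  induction ghosts with
  | nil => simp
  | cons g ghosts ih =>
    have : ∀ v, ((g :: ghosts).filter fun g => g.1 = v).length
        = (ghosts.filter fun g => g.1 = v).length + if g.1 = v then 1 else 0 := by
      intro v
      by_cases h : g.1 = v <;> simp [h]
    simp only [this, Finset.sum_add_distrib, ih]
    simp

/-- Peeling a tree with an even total number of defects and ghosts produces a matching of the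
defects, which differs from the ghost paths by paths between the defects. -/
theorem peel_spec (order : List (Site d) → List (Site d)) (horder : ∀ l, (order l).Perm l)
    (C : Cluster d) (hn : C.members.Nodup) (hC : IsTreeOn C.members.toFinset C.tree)
    (ghosts : List (Site d × Side)) (hg : ∀ g ∈ ghosts, g.1 ∈ C.members)
    (heven : Even (C.members.length + ghosts.length)) :
    boundary (peel order C ghosts) = siteIndicator C.members ∧
      peel order C ghosts + (ghosts.map buildGhostMatch).sum ∈ pathSpan C.members := by
  have hinit : PeelInvariant C.members (siteIndicator C.members) (ghosts.map buildGhostMatch).sum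
      C.members.toFinset (initPeel C ghosts) := by
    refine ⟨hC, subset_rfl, fun v hv => ?_, ?_, ?_, ?_⟩
    · rw [List.mem_toFinset] at hv
      have h0 : (ghosts.filter fun g => g.1 = v) = [] := by
        rw [List.filter_eq_nil_iff]
        intro g hgm h
        exact hv (of_decide_eq_true h ▸ hg g hgm)
      simp only [initPeel, if_neg hv, h0]
      simp
    · simp only [initPeel, Finset.sum_add_distrib]
      rw [← Nat.cast_sum, sum_length_filter]
      have : ∑ v, (if v ∈ C.members then (1 : ZMod 2) else 0) = (C.members.length : ZMod 2) := by
        rw [← List.toFinset_card_of_nodup hn, Finset.sum_boole]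
        congr 2
        ext v
        simp
      rw [this, ← Nat.cast_add, ZMod.natCast_eq_zero_iff]
      exact heven.two_dvd
    · funext v
      simp only [Pi.add_apply, initPeel, boundary_sum_buildGhostMatch, siteIndicator]
      rw [add_left_comm, CharTwo.add_self_eq_zero, add_zero]
    · simp only [initPeel, add_self_zmod_two]
      exact Submodule.zero_mem _
  obtain ⟨⟨V, h⟩, hlen⟩ := hinit.iterate
    (fun v hv => (horder C.members).mem_iff.2 hv) C.tree.length
  have h0 : V.card = 1 := by
    rw [h.tree.card]
    have : (initPeel C ghosts).tree.length = C.tree.length := rfl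
    omega
  -- After as many sweeps as there were edges a single vertex is left. It is off because the total
  -- parity, even at the start by `heven`, is preserved.
  obtain ⟨ρ, rfl⟩ := Finset.card_eq_one.1 h0
  have hoff : ((fun st => (order C.members).foldl peelVertex st)^[C.tree.length]
      (initPeel C ghosts)).on = 0 := by
    funext v
    by_cases hv : v = ρ
    · have := h.sum_on
      rw [Finset.sum_eq_single ρ (fun w _ hw => h.on_eq_zero w (by simpa using hw)) (by simp)]
        at this
      rw [hv, this]; rfl
    · exact h.on_eq_zero v (by simpa using hv)
  have hb := h.boundary_add
  rw [hoff, add_zero] at hb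
  exact ⟨hb, h.chain_add_mem⟩

/-! ### Splitting an error along the clusters -/

theorem boundary_single (q : Qubit d) : boundary (Pi.single q 1) = fun v => star v q := by
  funext v
  rw [boundary_apply, Finset.sum_eq_single q]
  · simp
  · intro b _ hb
    simp [hb]
  · simp

theorem star_ne_zero_inl {v : Site d} {r c : Fin d} : star v (Sum.inl (r, c)) ≠ 0 ↔
    r = v.1 ∧ (c.val = v.2.val ∨ c.val = v.2.val + 1) := by
  simp [star]
  tauto

theorem star_ne_zero_inr {v : Site d} {r c : Fin (d - 1)} : star v (Sum.inr (r, c)) ≠ 0 ↔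
    c = v.2 ∧ (r.val = v.1.val ∨ r.val + 1 = v.1.val) := by
  simp [star]
  tauto

theorem star_eq_of_ne {u v : Site d} {q : Qubit d} (hu : star u q ≠ 0) (hv : star v q ≠ 0)
    (huv : u ≠ v) : (fun w => star w q) = Pi.single u 1 + Pi.single v 1 := by
  funext w
  have h : star w q ≠ 0 ↔ w = u ∨ w = v := by
    constructor
    · intro hw
      obtain ⟨⟨u1, _⟩, ⟨u2, _⟩⟩ := u
      obtain ⟨⟨v1, _⟩, ⟨v2, _⟩⟩ := v
      obtain ⟨⟨w1, _⟩, ⟨w2, _⟩⟩ := w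
      rcases q with ⟨⟨r, _⟩, ⟨c, _⟩⟩ | ⟨⟨r, _⟩, ⟨c, _⟩⟩
      · rw [star_ne_zero_inl] at hu hv hw
        simp only [Prod.mk.injEq, Fin.mk.injEq, ne_eq] at *
        omega
      · rw [star_ne_zero_inr] at hu hv hw
        simp only [Prod.mk.injEq, Fin.mk.injEq, ne_eq] at *
        omega
    · rintro (rfl | rfl) <;> assumption
  simp only [Pi.add_apply, Pi.single_apply]
  by_cases h1 : w = u
  · have h2 : w ≠ v := fun h2 => huv (h1.symm.trans h2)
    rw [if_pos h1, if_neg h2, add_zero]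
    exact zmod_two_ne_zero.1 (h.2 (Or.inl h1))
  · by_cases h2 : w = v
    · rw [if_neg h1, if_pos h2, zero_add]
      exact zmod_two_ne_zero.1 (h.2 (Or.inr h2))
    · rw [if_neg h1, if_neg h2, add_zero]
      by_contra h0
      exact (h.1 h0).elim h1 h2

theorem manhattan_le_one {u v : Site d} {q : Qubit d} (hu : star u q ≠ 0) (hv : star v q ≠ 0) :
    manhattan u v ≤ 1 := by
  obtain ⟨⟨u1, _⟩, ⟨u2, _⟩⟩ := u
  obtain ⟨⟨v1, _⟩, ⟨v2, _⟩⟩ := v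
  unfold manhattan
  rcases q with ⟨⟨r, _⟩, ⟨c, _⟩⟩ | ⟨⟨r, _⟩, ⟨c, _⟩⟩
  · rw [star_ne_zero_inl] at hu hv
    simp only [Fin.mk.injEq] at *
    omega
  · rw [star_ne_zero_inr] at hu hv
    simp only [Fin.mk.injEq] at *
    omega

theorem manhattan_triangle (u v w : Site d) : manhattan u w ≤ manhattan u v + manhattan v w := by
  unfold manhattan; omega

theorem card_star_le (q : Qubit d) : (Finset.univ.filter fun v : Site d => star v q ≠ 0).card ≤ 2 := by
  by_contra! h
  obtain ⟨a, b, c, ha, hb, hc, hab, hac, hbc⟩ := Finset.two_lt_card_iff.1 h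
  simp only [Finset.mem_filter, Finset.mem_univ, true_and] at ha hb hc
  have := congrFun (star_eq_of_ne ha hb hab) c
  apply hc
  simpa [hac.symm, hbc.symm] using this

theorem card_boundary_le (e : Chain d) :
    (Finset.univ.filter fun v => boundary e v ≠ 0).card ≤ 2 * e.weight := by
  have hsub : (Finset.univ.filter fun v => boundary e v ≠ 0)
      ⊆ (Finset.univ.filter fun q => e q ≠ 0).biUnion
          fun q => Finset.univ.filter fun v : Site d => star v q ≠ 0 := by
    intro v hv
    replace hv := (Finset.mem_filter.1 hv).2
    rw [boundary_apply] at hv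
    obtain ⟨q, -, hq⟩ := Finset.exists_ne_zero_of_sum_ne_zero hv
    simp only [Finset.mem_biUnion, Finset.mem_filter, Finset.mem_univ, true_and]
    exact ⟨q, right_ne_zero_of_mul hq, left_ne_zero_of_mul hq⟩
  refine (Finset.card_le_card hsub).trans ?_
  rw [mul_comm]
  exact Finset.card_biUnion_le_card_mul _ _ _ fun q _ => card_star_le q

/-- The graph on the sites whose edges are the edges of a chain. -/
def chainGraph (e : Chain d) : SimpleGraph (Site d) where
  Adj u v := u ≠ v ∧ ∃ q, e q ≠ 0 ∧ star u q ≠ 0 ∧ star v q ≠ 0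
  symm := ⟨fun _ _ ⟨h, q, h0, h1, h2⟩ => ⟨h.symm, q, h0, h2, h1⟩⟩
  loopless := ⟨fun _ h => h.1 rfl⟩

theorem weight_single_add (q : Qubit d) (P : Chain d) (h : P q = 0) :
    Chain.weight (Pi.single q 1 + P) = P.weight + 1 := by
  have : (Finset.univ.filter fun q' => (Pi.single q 1 + P : Chain d) q' ≠ 0)
      = insert q (Finset.univ.filter fun q' => P q' ≠ 0) := by
    ext q'
    by_cases hq : q' = q
    · subst hq; simp [h]
    · simp [hq]
  unfold Chain.weight
  rw [this, Finset.card_insert_of_notMem (by simpa using h)]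

/-- The chain of a path. -/
theorem exists_chain_of_isPath (e : Chain d) {u v : Site d} (p : (chainGraph e).Walk u v)
    (hp : p.IsPath) : ∃ P : Chain d,
      (∀ q, P q ≠ 0 → e q ≠ 0 ∧ ∃ x ∈ p.support, ∃ y ∈ p.support, x ≠ y ∧ star x q ≠ 0 ∧ star y q ≠ 0)
      ∧ boundary P = Pi.single u 1 + Pi.single v 1 ∧ manhattan u v ≤ P.weight := by
  induction p with
  | nil =>
    refine ⟨0, fun q h => absurd rfl h, ?_, ?_⟩
    · rw [map_zero, add_self_zmod_two]
    · simp [manhattan]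
  | @cons u u' v h p ih =>
    rw [SimpleGraph.Walk.cons_isPath_iff] at hp
    obtain ⟨P, hP, hb, hw⟩ := ih hp.1
    obtain ⟨hne, q, hq, hu, hu'⟩ := id h
    have hstar := star_eq_of_ne hu hu' hne
    -- The first edge is not used again: its end `u` does not occur in the rest of the path, and an
    -- edge of `P` needs two ends there.
    have hPq : P q = 0 := by
      by_contra h0
      obtain ⟨-, x, hx, y, hy, hxy, hxq, hyq⟩ := hP q h0
      have key : ∀ z ∈ p.support, star z q ≠ 0 → z = u' := by
        intro z hz hzq
        have hzu : z ≠ u := fun h => hp.2 (h ▸ hz)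
        by_contra hzu'
        apply hzq
        have := congrFun hstar z
        simpa [hzu, hzu'] using this
      exact hxy ((key x hx hxq).trans (key y hy hyq).symm)
    refine ⟨Pi.single q 1 + P, fun q' hq' => ?_, ?_, ?_⟩
    · rw [SimpleGraph.Walk.support_cons]
      by_cases hqq : q' = q
      · subst hqq
        exact ⟨hq, u, List.mem_cons_self, u', List.mem_cons_of_mem _ p.start_mem_support, hne, hu, hu'⟩
      · have : P q' ≠ 0 := by simpa [hqq] using hq'
        obtain ⟨h0, x, hx, y, hy, h⟩ := hP q' this
        exact ⟨h0, x, List.mem_cons_of_mem _ hx, y, List.mem_cons_of_mem _ hy, h⟩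
    · rw [map_add, boundary_single, hstar, hb, add_assoc, ← add_assoc (Pi.single u' 1),
        add_self_zmod_two, zero_add]
    · rw [weight_single_add q P hPq]
      have := manhattan_triangle u u' v
      have := manhattan_le_one hu hu'
      omega

theorem weight_add_of_subset (e P : Chain d) (h : ∀ q, P q ≠ 0 → e q ≠ 0) :
    (e + P).weight + P.weight = e.weight := by
  unfold Chain.weight
  rw [← Finset.card_union_of_disjoint]
  · congr 1
    ext q
    simp only [Finset.mem_union, Finset.mem_filter, Finset.mem_univ, true_and, Pi.add_apply]
    have := h q
    generalize e q = a at *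
    generalize P q = b at *
    revert a b; decide
  · rw [Finset.disjoint_left]
    intro q h1 h2
    simp only [Finset.mem_filter, Finset.mem_univ, true_and, Pi.add_apply] at h1 h2
    have := h q h2
    rw [zmod_two_ne_zero] at h2 this
    rw [h2, this] at h1
    exact h1 rfl

/-- Two sites that are joined by the error are within the bubble radius. -/
theorem manhattan_le_bubbleRadius (e : Chain d) (t : ℕ) (he : e.weight ≤ t) (x y : Site d)
    (hr : (chainGraph e).Reachable x y) :
    (manhattan x y : ℤ) ≤ bubbleRadius t (defects (boundary e)).length := by
  obtain ⟨p, hp⟩ := hr.exists_isPath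
  obtain ⟨P, hP, hb, hw⟩ := exists_chain_of_isPath e p hp
  have hweight := weight_add_of_subset e P fun q hq => (hP q hq).1
  -- Removing the path from the error changes the syndrome only at its two ends.
  have hcard : (Finset.univ.filter fun v => boundary e v ≠ 0).card
      ≤ (Finset.univ.filter fun v => boundary (e + P) v ≠ 0).card + 2 := by
    have hsub : (Finset.univ.filter fun v => boundary e v ≠ 0)
        ⊆ (Finset.univ.filter fun v => boundary (e + P) v ≠ 0) ∪ {x, y} := by
      intro v hv
      simp only [Finset.mem_filter, Finset.mem_univ, true_and, Finset.mem_union,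
        Finset.mem_insert, Finset.mem_singleton, map_add, hb, Pi.add_apply] at hv ⊢
      by_cases h : v = x ∨ v = y
      · exact Or.inr h
      · push Not at h
        left
        simpa [h.1, h.2] using hv
    refine (Finset.card_le_card hsub).trans ((Finset.card_union_le _ _).trans ?_)
    have := Finset.card_le_two (a := x) (b := y)
    omega
  have hle := card_boundary_le (e + P)
  rw [← length_defects] at hcard
  have hceil := Int.ceil_lt_add_one (((defects (boundary e)).length : ℚ) / 2)
  unfold bubbleRadius
  set n := (defects (boundary e)).length
  -- The remaining `n - 2` or more defects need half as many edges, so `n - 2 ≤ 2 * (t - P.weight)`.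
  -- This crude bound on the ceiling suffices because the radius exceeds the resulting distance
  -- bound `t + 1 - ⌈n / 2⌉` by one.
  have h2 : 2 * ⌈(n : ℚ) / 2⌉ < (n : ℤ) + 2 := by
    have : (2 * ⌈(n : ℚ) / 2⌉ : ℚ) < (n : ℚ) + 2 := by linarith
    exact_mod_cast this
  omega

/-- The part of a chain that is joined to a set of its defects. -/
theorem exists_restriction (e : Chain d) (M : List (Site d)) (hM : ∀ v ∈ M, boundary e v = 1)
    (hclosed : ∀ x ∈ M, ∀ y, boundary e y = 1 → (chainGraph e).Reachable x y → y ∈ M) :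
    ∃ f : Chain d, (∀ q, f q ≠ 0 → e q ≠ 0) ∧ boundary f = siteIndicator M := by
  classical
  -- Keep the edges of `e` in the components that meet `M`: at a site of such a component all edges
  -- of `e` survive, at any other site none.
  refine ⟨fun q => if ∃ v, star v q ≠ 0 ∧ ∃ a ∈ M, (chainGraph e).Reachable a v then e q else 0,
    fun q hq => (ite_ne_right_iff.1 hq).2, ?_⟩
  funext v
  by_cases hv : ∃ a ∈ M, (chainGraph e).Reachable a v
  · have : boundary e v = siteIndicator M v := by
      unfold siteIndicator
      split_ifs with h
      · exact hM v h
      · obtain ⟨a, ha, hav⟩ := hv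
        by_contra h0
        exact h (hclosed a ha v (zmod_two_ne_zero.1 h0) hav)
    rw [← this, boundary_apply, boundary_apply]
    refine Finset.sum_congr rfl fun q _ => ?_
    by_cases hq : star v q = 0
    · rw [hq, zero_mul, zero_mul]
    · rw [if_pos ⟨v, hq, hv⟩]
  · have hvM : v ∉ M := fun h => hv ⟨v, h, SimpleGraph.Reachable.refl v⟩
    rw [boundary_apply, siteIndicator, if_neg hvM]
    refine Finset.sum_eq_zero fun q _ => ?_
    by_contra h0
    have h1 := left_ne_zero_of_mul h0
    obtain ⟨⟨w, hw, a, ha, haw⟩, h3⟩ := ite_ne_right_iff.1 (right_ne_zero_of_mul h0)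
    by_cases hwv : w = v
    · exact hv ⟨a, ha, hwv ▸ haw⟩
    · exact hv ⟨a, ha, haw.trans (SimpleGraph.Adj.reachable ⟨hwv, q, h3, hw, h1⟩)⟩

/-- Defects joined by the error are within the radius, while defects of different clusters are
farther apart; so a cluster contains all defects of every component that it meets. -/
theorem exists_cluster_error (e : Chain d) (t : ℕ) (he : e.weight ≤ t) (C : Cluster d)
    (hC : C ∈ clusters (bubbleRadius t (defects (boundary e)).length) (defects (boundary e))) :
    ∃ f : Chain d, (∀ q, f q ≠ 0 → e q ≠ 0) ∧ boundary f = siteIndicator C.members := by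
  have hM : ∀ v ∈ C.members, boundary e v = 1 := fun v hv =>
    mem_defects.1 (clusters_subset _ _ C hC hv)
  refine exists_restriction e C.members hM fun x hx y hy hxy => ?_
  by_contra hyM
  have h1 := manhattan_le_bubbleRadius e t he x y hxy
  have h2 := clusters_separated _ _ C hC x hx y (mem_defects.2 hy) hyM
  omega

/-! ### The two matchings of a cluster -/

/-- The chains that consist of horizontal edges of the row `r`. -/
def rowChains (r : Fin d) : Submodule (ZMod 2) (Chain d) where
  carrier := {z | ∀ q, z q ≠ 0 → ∃ c, q = Sum.inl (r, c)}
  zero_mem' := fun _ h => absurd rfl h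
  add_mem' := by
    intro x y hx hy q hq
    by_cases h : x q = 0
    · exact hy q fun h' => hq (by rw [Pi.add_apply, h, h', add_zero])
    · exact hx q h
  smul_mem' := fun _ _ hx q hq => hx q (right_ne_zero_of_mul hq)

theorem pathSpan_le_rowChains {M : List (Site d)} {r : Fin d} (hM : ∀ v ∈ M, v.1 = r) :
    pathSpan M ≤ rowChains r := by
  rw [pathSpan, Submodule.span_le]
  rintro _ ⟨u, hu, v, hv, rfl⟩ q hq
  have h1 := hM u hu
  have h2 := hM v hv
  rcases q with ⟨i, c⟩ | ⟨i, c⟩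
  · have := (ite_ne_right_iff.1 hq).1.1
    exact ⟨c, by rw [this, h2]⟩
  · have := (ite_ne_right_iff.1 hq).1
    rw [h1, h2] at this
    omega

theorem buildGhostMatch_mem_rowChains (g : Site d × Side) : buildGhostMatch g ∈ rowChains g.1.1 := by
  rintro (⟨i, c⟩ | q) hq
  · obtain ⟨v, _ | _⟩ := g <;> exact ⟨c, by rw [(ite_ne_right_iff.1 hq).1.1]⟩
  · exact absurd rfl hq

theorem peel_mem_rowChains {M : List (Site d)} {r : Fin d} (hM : ∀ v ∈ M, v.1 = r)
    {ghosts : List (Site d × Side)} (hg : ∀ g ∈ ghosts, g.1 ∈ M) {z : Chain d}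
    (hz : z + (ghosts.map buildGhostMatch).sum ∈ pathSpan M) : z ∈ rowChains r := by
  have h1 := pathSpan_le_rowChains hM hz
  have h2 : (ghosts.map buildGhostMatch).sum ∈ rowChains r := by
    refine list_sum_mem fun x hx => ?_
    obtain ⟨g, hgm, rfl⟩ := List.mem_map.1 hx
    rw [← hM _ (hg g hgm)]
    exact buildGhostMatch_mem_rowChains g
  have h3 := Submodule.add_mem _ h1 h2
  rwa [add_assoc, add_self_zmod_two, add_zero] at h3

/-- Column 0 lies to the left of all sites, so only ghost paths to the left boundary cross it. This
makes it the convenient column for comparing the two matchings. -/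
theorem columnParity_buildMatch (hd : 0 < d) (u v : Site d) :
    columnParity ⟨0, hd⟩ (buildMatch u v) = 0 := by
  rw [columnParity_apply]
  refine Finset.sum_eq_zero fun r _ => ?_
  simp [buildMatch]

theorem columnParity_pathSpan (hd : 0 < d) {M : List (Site d)} {z : Chain d} (hz : z ∈ pathSpan M) :
    columnParity ⟨0, hd⟩ z = 0 := by
  have : pathSpan M ≤ LinearMap.ker (columnParity ⟨0, hd⟩) := by
    rw [pathSpan, Submodule.span_le]
    rintro _ ⟨u, -, v, -, rfl⟩
    exact columnParity_buildMatch hd u v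
  exact this hz

theorem columnParity_left (hd : 0 < d) (v : Site d) :
    columnParity ⟨0, hd⟩ (buildGhostMatch (v, Side.left)) = 1 := by
  rw [columnParity_apply]
  simp [buildGhostMatch]

theorem columnParity_right (hd : 0 < d) (v : Site d) :
    columnParity ⟨0, hd⟩ (buildGhostMatch (v, Side.right)) = 0 := by
  rw [columnParity_apply]
  simp [buildGhostMatch]

theorem exists_nearestDefect {l : List (Site d)} (hl : l ≠ []) (dist : Site d → ℕ) :
    ∃ v ∈ l, nearestDefect l dist = some v := by
  obtain ⟨w, hw⟩ := List.exists_mem_of_ne_nil l hl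
  unfold nearestDefect
  cases h : ((allSites d).filter fun v => v ∈ l).argmin fun v =>
    toLex (dist v, OrderDual.toDual (neighbourDist l v)) with
  | none =>
    rw [List.argmin_eq_none, List.filter_eq_nil_iff] at h
    exact absurd (decide_eq_true hw) (h w (mem_allSites w))
  | some v =>
    exact ⟨v, of_decide_eq_true (List.mem_filter.1 (List.argmin_mem h)).2, rfl⟩

theorem exists_ghostAt {l : List (Site d)} (hl : l ≠ []) (b : Side) :
    ∃ v ∈ l, ghostAt l b = [(v, b)] := by
  obtain ⟨v, hv, h⟩ := exists_nearestDefect hl fun v => boundaryDist v b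
  exact ⟨v, hv, by rw [ghostAt, h]; rfl⟩

theorem ghosts_odd (tie : Site d → Side) {l : List (Site d)} (hl : l ≠ []) (ho : Odd l.length) :
    ∃ u ∈ l, ∃ v ∈ l, ∃ b, firstGhosts tie l = [(u, b)] ∧ secondGhosts tie l = [(v, b.opposite)] := by
  obtain ⟨u, hu, h⟩ := exists_nearestDefect hl fun v => min (boundaryDist v .left) (boundaryDist v .right)
  have h1 : firstGhosts tie l = [(u, nearestSide tie u)] := by
    rw [firstGhosts, if_pos ho, h]; rfl
  obtain ⟨v, hv, h2⟩ := exists_ghostAt hl (nearestSide tie u).opposite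
  refine ⟨u, hu, v, hv, _, h1, ?_⟩
  rw [secondGhosts, if_pos ho, h1, List.flatMap_singleton, h2]

theorem ghosts_even (tie : Site d → Side) {l : List (Site d)} (hl : l ≠ []) (ho : ¬ Odd l.length) :
    firstGhosts tie l = [] ∧
      ∃ u ∈ l, ∃ v ∈ l, secondGhosts tie l = [(u, Side.left), (v, Side.right)] := by
  refine ⟨by rw [firstGhosts, if_neg ho], ?_⟩
  obtain ⟨u, hu, h1⟩ := exists_ghostAt hl Side.left
  obtain ⟨v, hv, h2⟩ := exists_ghostAt hl Side.right
  exact ⟨u, hu, v, hv, by rw [secondGhosts, if_neg ho, h1, h2]; rfl⟩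

/-- Whatever the parity of the cluster, the two phases together use one ghost at each boundary; this
puts the two matchings into different homology classes. -/
theorem ghosts_spec (tie : Site d → Side) {l : List (Site d)} (hl : l ≠ []) :
    (∀ g ∈ firstGhosts tie l, g.1 ∈ l) ∧ (∀ g ∈ secondGhosts tie l, g.1 ∈ l) ∧
    Even (l.length + (firstGhosts tie l).length) ∧
    Even (l.length + (secondGhosts tie l).length) ∧
    ∀ hd : 0 < d, columnParity ⟨0, hd⟩ ((firstGhosts tie l).map buildGhostMatch).sum
      + columnParity ⟨0, hd⟩ ((secondGhosts tie l).map buildGhostMatch).sum = 1 := by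
  by_cases ho : Odd l.length
  · obtain ⟨u, hu, v, hv, b, h1, h2⟩ := ghosts_odd tie hl ho
    rw [h1, h2]
    refine ⟨by simpa using hu, by simpa using hv, by simpa using ho.add_one,
      by simpa using ho.add_one, fun hd => ?_⟩
    cases b <;> simp [Side.opposite, columnParity_left, columnParity_right]
  · obtain ⟨h1, u, hu, v, hv, h2⟩ := ghosts_even tie hl ho
    rw [Nat.not_odd_iff_even] at ho
    rw [h1, h2]
    refine ⟨by simp, by simp [hu, hv], by simpa using ho, ?_, fun hd => ?_⟩
    · exact ho.add even_two
    · simp [columnParity_left, columnParity_right]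

/-! ### Post-processing -/

theorem columnMetric_eq (e : Chain d) :
    columnMetric e = (Finset.univ.filter fun k => columnParity k e ≠ 0).card := by
  rw [columnMetric, Finset.card_filter]
  refine Finset.sum_congr rfl fun k _ => ?_
  have h : columnParity k e = ((Finset.univ.filter fun r : Fin d => e (Sum.inl (r, k)) ≠ 0).card : ZMod 2) := by
    rw [columnParity_apply, ← Finset.sum_boole]
    refine Finset.sum_congr rfl fun r _ => ?_
    split_ifs with h
    · exact zmod_two_ne_zero.1 h
    · exact not_not.1 h
  rw [h]
  split_ifs with h2 <;> rw [ne_eq, ZMod.natCast_eq_zero_iff] at h2 <;> omega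

/-- A common edge cancels in the sum and makes its weight strictly smaller than the sum of the
weights. -/
theorem disjoint_of_weight_add {f a : Chain d} (h : f.weight + a.weight ≤ (f + a).weight) (q : Qubit d)
    (hf : f q ≠ 0) : a q = 0 := by
  by_contra ha
  unfold Chain.weight at h
  have hsub : (Finset.univ.filter fun q => (f + a) q ≠ 0)
      ⊆ ((Finset.univ.filter fun q => f q ≠ 0) ∪ (Finset.univ.filter fun q => a q ≠ 0)).erase q := by
    intro q' hq'
    simp only [Finset.mem_filter, Finset.mem_univ, true_and, Finset.mem_erase, Finset.mem_union,
      Pi.add_apply] at hq' ⊢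
    constructor
    · rintro rfl
      rw [zmod_two_ne_zero.1 hf, zmod_two_ne_zero.1 ha] at hq'
      exact hq' rfl
    · by_contra! h0
      rw [h0.1, h0.2] at hq'
      exact hq' rfl
  have h1 := Finset.card_le_card hsub
  rw [Finset.card_erase_of_mem (by simp [hf])] at h1
  have h2 := Finset.card_union_le (Finset.univ.filter fun q => f q ≠ 0) (Finset.univ.filter fun q => a q ≠ 0)
  have h3 : 0 < (Finset.univ.filter fun q => f q ≠ 0).card := Finset.card_pos.2 ⟨q, by simpa using hf⟩
  omega

/-- A matching of weight `t + 1` is equivalent to the error, unless the other matching is the error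
itself. -/
theorem mem_of_weight_succ {t : ℕ} (hd : 2 * t + 1 ≤ d) {f a b : Chain d} (hf : f.weight ≤ t)
    (ha : boundary (f + a) = 0)
    (hab : ∀ k, columnParity k (a + b) = 1) (hrow : ∀ r, f ∈ rowChains r → b ∈ rowChains r)
    (hwa : a.weight = t + 1) (hwb : ¬ b.weight ≤ t) : f + a ∈ bordersSpan d := by
  refine mem_bordersSpan _ ha fun k => ?_
  by_contra hk
  have hw := Chain.weight_add_le f a
  have hle := le_weight _ ha k hk
  -- The weights give `d ≤ (f + a).weight ≤ 2 * t + 1 ≤ d`. All are equalities, so the cycle is a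
  -- row and `f` and `a` are disjoint parts of it.
  obtain ⟨r, hr⟩ := exists_row _ ha k hk (by omega)
  have hdis := disjoint_of_weight_add (f := f) (a := a) (by omega)
  have hfr : f ∈ rowChains r := by
    intro q hq
    refine hr q ?_
    rwa [Pi.add_apply, hdis q hq, add_zero]
  have hbr := hrow r hfr
  -- In each column the odd parities of `f + a` and `a + b` cancel; an even cycle confined to a row
  -- is empty.
  have h0 : f + b = 0 := by
    refine eq_zero_of_row _ r (Submodule.add_mem _ hfr hbr) fun l => ?_
    have h1 : columnParity l (f + a) = 1 := by
      rw [columnParity_eq _ ha l k]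
      exact zmod_two_ne_zero.1 hk
    have h2 : f + b = (f + a) + (a + b) := by
      rw [add_assoc, ← add_assoc a a b, add_self_zmod_two, zero_add]
    rw [h2, map_add, h1, hab l]
    rfl
  have hfb : b = f := by
    have := congrArg (f + ·) h0
    simpa [← add_assoc, add_self_zmod_two] using this
  rw [hfb] at hwb
  exact hwb hf

/-- The column metric depends only on the homology class, so for the right matching it is bounded by
the weight of the error. -/
theorem columnMetric_of_mem {f e : Chain d} (h : f + e ∈ bordersSpan d) :
    columnMetric e ≤ f.weight := by
  have hk : ∀ k, columnParity k e = columnParity k f := fun k => by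
    have := columnParity_of_mem_bordersSpan h k
    rw [map_add] at this
    exact (zmod_two_add_eq_zero.1 this).symm
  rw [columnMetric_eq]
  simp only [hk]
  exact card_columnParity_le f

/-- Each column is crossed an odd number of times by exactly one of the two matchings. -/
theorem columnMetric_add {a b : Chain d} (hab : ∀ k, columnParity k (a + b) = 1) :
    columnMetric a + columnMetric b = d := by
  have hk : ∀ k, columnParity k b ≠ 0 ↔ ¬ columnParity k a ≠ 0 := fun k => by
    have := hab k
    rw [map_add] at this
    generalize columnParity k a = x at *
    generalize columnParity k b = y at *
    revert x y; decide
  rw [columnMetric_eq, columnMetric_eq]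
  simp only [hk]
  rw [Finset.card_filter_add_card_filter_not, Finset.card_univ, Fintype.card_fin]

theorem selectMatching_correct {t : ℕ} (hd : 2 * t + 1 ≤ d) {f a b : Chain d} (hf : f.weight ≤ t)
    (ha : boundary (f + a) = 0) (hb : boundary (f + b) = 0)
    (hab : ∀ k, columnParity k (a + b) = 1)
    (hrow : ∀ r, f ∈ rowChains r → a ∈ rowChains r ∧ b ∈ rowChains r) :
    f + selectMatching t a b ∈ bordersSpan d := by
  have hba : ∀ k, columnParity k (b + a) = 1 := fun k => by rw [add_comm, hab k]
  have hsmall : ∀ e : Chain d, boundary (f + e) = 0 → e.weight ≤ t → f + e ∈ bordersSpan d := by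
    intro e he hw
    have := Chain.weight_add_le f e
    exact mem_bordersSpan_of_weight_lt _ he (by omega)
  have hor : f + a ∈ bordersSpan d ∨ f + b ∈ bordersSpan d := by
    let k : Fin d := ⟨0, by omega⟩
    by_cases h : columnParity k (f + a) = 0
    · exact Or.inl (mem_bordersSpan _ ha fun l => by rw [columnParity_eq _ ha l k, h])
    · refine Or.inr (mem_bordersSpan _ hb fun l => ?_)
      have h2 : f + b = (f + a) + (a + b) := by
        rw [add_assoc, ← add_assoc a a b, add_self_zmod_two, zero_add]
      rw [columnParity_eq _ hb l k, h2, map_add, hab k, zmod_two_ne_zero.1 h]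
      rfl
  have hsum := columnMetric_add hab
  unfold selectMatching
  split_ifs with h1 h2 h3 h4 h5
  · exact hsmall a ha h1
  · exact hsmall b hb h2
  · exact mem_of_weight_succ hd hf ha hab (fun r h => (hrow r h).2) h3 h2
  · exact mem_of_weight_succ hd hf hb hba (fun r h => (hrow r h).1) h4 h1
  · refine hor.resolve_right fun h => ?_
    have := columnMetric_of_mem h
    omega
  · refine hor.resolve_left fun h => ?_
    have := columnMetric_of_mem h
    omega

/-! ### Correctness of the decoder: from one cluster to the whole code -/

theorem decodeCluster_correct {t : ℕ} (hd : 2 * t + 1 ≤ d) (tie : Site d → Side)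
    (order : List (Site d) → List (Site d)) (horder : ∀ l, (order l).Perm l) (C : Cluster d)
    (hne : C.members ≠ []) (hn : C.members.Nodup) (hC : IsTreeOn C.members.toFinset C.tree)
    {f : Chain d} (hf : f.weight ≤ t) (hb : boundary f = siteIndicator C.members) :
    f + decodeCluster t tie order C ∈ bordersSpan d := by
  obtain ⟨hg1, hg2, hev1, hev2, hpar⟩ := ghosts_spec tie hne
  obtain ⟨hb1, hp1⟩ := peel_spec order horder C hn hC _ hg1 hev1
  obtain ⟨hb2, hp2⟩ := peel_spec order horder C hn hC _ hg2 hev2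
  have hd0 : 0 < d := by omega
  have hcyc : ∀ {x y : Chain d}, boundary x = siteIndicator C.members →
      boundary y = siteIndicator C.members → boundary (x + y) = 0 := by
    intro x y hx hy
    rw [map_add, hx, hy, add_self_zmod_two]
  refine selectMatching_correct hd hf (hcyc hb hb1) (hcyc hb hb2) (fun k => ?_) fun r hr => ?_
  · rw [columnParity_eq _ (hcyc hb1 hb2) k ⟨0, hd0⟩, ← hpar hd0, map_add]
    have h1 := columnParity_pathSpan hd0 hp1
    have h2 := columnParity_pathSpan hd0 hp2
    rw [map_add] at h1 h2
    rw [zmod_two_add_eq_zero.1 h1, zmod_two_add_eq_zero.1 h2]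
  -- An error confined to a row has all its defects there, and then every path between defects or to
  -- a boundary stays in that row.
  · have hM : ∀ v ∈ C.members, v.1 = r := by
      intro v hv
      have hv1 : boundary f v ≠ 0 := by
        rw [hb, siteIndicator, if_pos hv]
        exact one_ne_zero
      rw [boundary_apply] at hv1
      obtain ⟨q, -, hq⟩ := Finset.exists_ne_zero_of_sum_ne_zero hv1
      obtain ⟨c, rfl⟩ := hr q (right_ne_zero_of_mul hq)
      exact (star_ne_zero_inl.1 (left_ne_zero_of_mul hq)).1.symm
    exact ⟨peel_mem_rowChains hM hg1 hp1, peel_mem_rowChains hM hg2 hp2⟩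

theorem decodeLattice_correct {t : ℕ} (hd : 2 * t + 1 ≤ d) (tie : Site d → Side)
    (order : List (Site d) → List (Site d)) (horder : ∀ l, (order l).Perm l) (e : Chain d)
    (he : e.weight ≤ t) : e + decodeLattice t tie order (boundary e) ∈ bordersSpan d := by
  set L := clusters (bubbleRadius t (defects (boundary e)).length) (defects (boundary e)) with hL
  have hex := exists_cluster_error e t he
  rw [← hL] at hex
  choose! f hf hfb using hex
  have htree := clusters_isTreeOn (bubbleRadius t (defects (boundary e)).length) _
    (nodup_defects (boundary e))
  rw [← hL] at htree
  have hsupp : ∀ q, (L.map f).sum q ≠ 0 → e q ≠ 0 := by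
    intro q hq h0
    apply hq
    have : (L.map f).sum ∈ LinearMap.ker (LinearMap.proj q : Chain d →ₗ[ZMod 2] ZMod 2) := by
      refine list_sum_mem fun x hx => ?_
      obtain ⟨C, hC, rfl⟩ := List.mem_map.1 hx
      by_contra h
      exact hf C hC q h h0
    exact this
  have hbd : boundary (L.map f).sum = boundary e := by
    funext v
    have h1 : boundary (L.map f).sum v = (L.map fun C => boundary (f C) v).sum := by
      have := map_list_sum ((LinearMap.proj v).comp boundary : Chain d →ₗ[ZMod 2] ZMod 2) (L.map f)
      rw [List.map_map] at this
      exact this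
    have h2 : (L.map fun C => boundary (f C) v)
        = L.map fun C => if v ∈ C.members then (1 : ZMod 2) else 0 :=
      List.map_congr_left fun C hC => by rw [hfb C hC]; rfl
    rw [h1, h2, hL, clusters_sum _ _ (nodup_defects _)]
    simp only [mem_defects]
    split_ifs with h
    · exact h.symm
    · by_contra h0
      exact h (zmod_two_ne_zero.1 (Ne.symm h0))
  -- The sum of the pieces is supported in `e`, so what they leave over is a cycle of weight at most
  -- `t < d`, hence trivial. The pieces need not be disjoint for this.
  have hrest : e + (L.map f).sum ∈ bordersSpan d := by
    refine mem_bordersSpan_of_weight_lt _ (by rw [map_add, hbd, add_self_zmod_two]) ?_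
    have := weight_add_of_subset e _ hsupp
    omega
  have hclusters : (L.map fun C => f C + decodeCluster t tie order C).sum ∈ bordersSpan d := by
    refine list_sum_mem fun x hx => ?_
    obtain ⟨C, hC, rfl⟩ := List.mem_map.1 hx
    obtain ⟨hne, hn, hT⟩ := htree C hC
    exact decodeCluster_correct hd tie order horder C hne hn hT
      ((Chain.weight_mono (hf C hC)).trans he) (hfb C hC)
  rw [List.sum_map_add] at hclusters
  have := Submodule.add_mem _ hrest hclusters
  rwa [add_assoc, ← add_assoc (L.map f).sum, add_self_zmod_two, zero_add] at this

theorem bcDecoder_correct (hd : 1 ≤ d) (tie : Site d → Side)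
    (order : List (Site d) → List (Site d)) (horder : ∀ l, (order l).Perm l)
    (E : PauliPattern (Qubit d)) (hE : E.weight ≤ (d - 1) / 2) :
    E + bcDecoder ((d - 1) / 2) tie order (syndromeOf (generator d) E)
      ∈ stabilizerOf (generator d) := by
  have hz : (fun v => syndromeOf (generator d) E (Sum.inl v)) = boundary (zPart E) :=
    funext fun v => symp_site v E
  have hx : (fun v : Site d => syndromeOf (generator d) E (Sum.inr (v.2, v.1)))
      = boundary (xPart E) :=
    funext fun v => symp_plaquette (v.2, v.1) E
  have ht : 2 * ((d - 1) / 2) + 1 ≤ d := by omega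
  have h1 : zPart (bcDecoder ((d - 1) / 2) tie order (syndromeOf (generator d) E))
      = decodeLattice ((d - 1) / 2) tie order (boundary (zPart E)) := by
    rw [← hz]; rfl
  have h2 : xPart (bcDecoder ((d - 1) / 2) tie order (syndromeOf (generator d) E))
      = decodeLattice ((d - 1) / 2) tie order (boundary (xPart E)) := by
    rw [← hx]
    funext q
    change decodeLattice _ _ _ _ (transpose (transpose q)) = _
    rw [transpose_transpose]
  rw [mem_stabilizer_iff, map_add, map_add, h1, h2]
  exact ⟨decodeLattice_correct ht tie order horder _ ((weight_zPart_le E).trans hE),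
    decodeLattice_correct ht tie order horder _ ((weight_xPart_le E).trans hE)⟩

end SurfaceCode

theorem theorem1 (d : ℕ) (hd : 1 ≤ d)
    (tie : SurfaceCode.Site d → SurfaceCode.Side)
    (order : List (SurfaceCode.Site d) → List (SurfaceCode.Site d))
    (horder : ∀ l, (order l).Perm l) :
    IsStabilizerCode (SurfaceCode.generator d) (d ^ 2 + (d - 1) ^ 2) 1 d ∧
    ∀ E : PauliPattern (SurfaceCode.Qubit d), E.weight ≤ (d - 1) / 2 →
      E + SurfaceCode.bcDecoder ((d - 1) / 2) tie order
        (syndromeOf (SurfaceCode.generator d) E) ∈ stabilizerOf (SurfaceCode.generator d) := by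
  exact ⟨SurfaceCode.isStabilizerCode hd, fun E hE =>
    SurfaceCode.bcDecoder_correct hd tie order horder E hE⟩
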